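/- **Conventions.** A Turing machine $T$ has a finite set of states containing an initial state $q_0$ and a halting state $q_{halt}$, a finite alphabet $\Sigma$ with at least two symbols, one of which is the blank symbol, and a transition function $\delta:Q\times\Sigma\to Q\times\Sigma\times\{-1,0,1\}$. From a state $q\ne q_{halt}$ and a tape $(t_i)_{i\in\mathbb Z}$ with $\delta(q,t_0)=(q',t_0',\varepsilon)$ it passes to the state $q'$, replaces $t_0$ by $t_0'$ and then shifts the tape by $\varepsilon$ (to the left if $\varepsilon=1$). It halts, and returns the current tape, when it reaches $q_{halt}$. Input tapes have finitely many non-blank symbols. A vector field $X$ on $M\subseteq\mathbb R^m$ is *Turing complete* if for every integer $k\ge 0$, every Turing machine $T$, every input tape $t$ and every string $t^*=(t^*_{-k},\dots,t^*_k)$ of symbols there are an explicit point $p\in M$ and an explicit open set $U\subseteq M$ such that the orbit of $X$ through $p$ intersects $U$ if and only if $T$, on input $t$, halts with an output tape whose positions $-k,\dots,k$ carry the symbols $t^*_{-k},\dots,t^*_k$. Explicit means: an algorithm computes from $(T,t,t^*)$ the coordinates of $p$, which are rational, and a finite description of $U$ as the intersection of $M$ with a finite union of finite intersections of sets $\{f>0\}$,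 $f$ a polynomial with rational coefficients. The orbit consists of all points reached in positive or negative time. A polynomial vector field is *constructible* if its coefficients are computable real numbers, and its degree is the maximum of the degrees of its components. A vector field $Y$ on $\mathbb S^n=\{y\in\mathbb R^{n+1}:|y|=1\}$ is polynomial (constructible, of degree $D$) if it is the restriction $X|_{\mathbb S^n}$ of a polynomial vector field $X$ on $\mathbb R^{n+1}$ (constructible, of degree $D$) that is tangent to $\mathbb S^n$. Let $\varphi:\mathbb R^n\to\mathbb S^n$ be the inverse stereographic projection, $$\varphi(x)=\Big(\frac{r^2-1}{1+r^2},\frac{2x_1}{1+r^2},\dots,\frac{2x_n}{1+r^2}\Big),\qquad r=|x|.$$ **Theorem.** For every $n\ge 17$ there are a constructible Turing complete polynomial vector field $P$ of degree $d=56$ on $\mathbb R^n$ and a constructible polynomial vector field $Y$ of degree $58$ on $\mathbb S^n$ such that $Y$ is Turing complete, $Y$ is the push-forward under $\varphi$ of the reparametrized field $\widetilde P=\frac{2^d}{(1+r^2)^d}P$, that is, $Y(\varphi(x))=D\varphi(x)\,\widetilde P(x)$ for all $x\in\mathbb R^n$, and the north pole $(1,0,\dots,0)$ is a zero of $Y$.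 -/

import Mathlib

namespace SphereTC

/-! ### Turing machines -/

/-- A Turing machine with states `Fin r` and alphabet `Fin s`; the symbol `0` is the blank.
The last component of `δ` is the shift `ε ∈ {-1, 0, 1}`. -/
structure TuringMachine (r s : ℕ) where
  start : Fin r
  halt : Fin r
  δ : Fin r → Fin s → Fin r × Fin s × SignType

namespace TuringMachine

variable {r s : ℕ}

/-- One step of the machine. At the halting state nothing happens any more. Otherwise the symbol in
position `0` is overwritten and the tape is shifted, `ε = 1` being the shift to the left. -/
def step (T : TuringMachine r s) (c : Fin r × (ℤ → Fin s)) : Fin r × (ℤ → Fin s) :=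
  if c.1 = T.halt then c
  else
    let a := T.δ c.1 (c.2 0)
    (a.1, fun n => Function.update c.2 0 a.2.1 (n + (a.2.2 : ℤ)))

/-- `T`, run on the input tape `t`, halts with an output tape whose positions `-k, …, k` carry the
symbols `u 0, …, u (2k)`. -/
def HaltsWithOutput (T : TuringMachine r s) (t : ℤ → Fin s) (k : ℕ)
    (u : Fin (2 * k + 1) → Fin s) : Prop :=
  ∃ j : ℕ, (T.step^[j] (T.start, t)).1 = T.halt ∧
    ∀ i : Fin (2 * k + 1), (T.step^[j] (T.start, t)).2 ((i : ℤ) - k) = u i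

/-- The transition table, written out as a list of numbers (shifts are written as `ε + 1`). -/
def table (T : TuringMachine r s) : List ℕ :=
  (List.ofFn fun q : Fin r => (List.ofFn fun a : Fin s =>
    [((T.δ q a).1 : ℕ), ((T.δ q a).2.1 : ℕ), (((T.δ q a).2.2 : ℤ) + 1).toNat]).flatten).flatten

/-- The finite word that describes the machine `T`, the symbols of the tape `t` in the
positions `-k₀, …, k₀`, and the string `u`. -/
def describe (T : TuringMachine r s) (k₀ : ℕ) (t : ℤ → Fin s) (k : ℕ)
    (u : Fin (2 * k + 1) → Fin s) : List (List ℕ) :=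
  [[r, s, T.start, T.halt], T.table,
    List.ofFn fun i : Fin (2 * k₀ + 1) => (t ((i : ℤ) - k₀) : ℕ),
    List.ofFn fun i : Fin (2 * k + 1) => (u i : ℕ)]

end TuringMachine

/-! ### Explicit points and explicit open sets -/

/-- The pair `(a, b)` denotes the rational number `a / (b + 1)`. -/
noncomputable def ratValue (c : ℤ × ℕ) : ℝ := (c.1 : ℝ) / ((c.2 : ℝ) + 1)

/-- The point with rational coordinates that is given by a list of fractions (missing entries are
read as `0`). -/
noncomputable def ratPoint (m : ℕ) (l : List (ℤ × ℕ)) : EuclideanSpace ℝ (Fin m) :=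
  WithLp.toLp 2 fun i => ratValue (l.getD i (0, 0))

/-- A polynomial with rational coefficients, as a list of terms (coefficient, exponents). -/
abbrev PolyWord : Type := List ((ℤ × ℕ) × List ℕ)

/-- The value of such a polynomial at the point `y`. -/
noncomputable def polyValue {m : ℕ} (f : PolyWord) (y : EuclideanSpace ℝ (Fin m)) : ℝ :=
  (f.map fun c => ratValue c.1 * ∏ i : Fin m, y i ^ (c.2.getD i 0)).sum

/-- The open semialgebraic set described by a finite list `L` of finite lists of polynomials with
rational coefficients: the union over `C ∈ L` of the sets on which all members of `C` are
positive. -/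
def semialgOpen (m : ℕ) (L : List (List PolyWord)) : Set (EuclideanSpace ℝ (Fin m)) :=
  {y | ∃ C ∈ L, ∀ f ∈ C, 0 < polyValue f y}

theorem continuous_polyValue {m : ℕ} (f : PolyWord) :
    Continuous (polyValue f : EuclideanSpace ℝ (Fin m) → ℝ) := by
  unfold polyValue
  induction f with
  | nil => simpa using continuous_const
  | cons c f ih =>
    simp only [List.map_cons, List.sum_cons]
    exact (by fun_prop : Continuous fun y : EuclideanSpace ℝ (Fin m) =>
      ratValue c.1 * ∏ i : Fin m, y i ^ (c.2.getD i 0)).add ih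

theorem isOpen_semialgOpen (m : ℕ) (L : List (List PolyWord)) : IsOpen (semialgOpen m L) := by
  have h : semialgOpen m L = ⋃ C ∈ L, ⋂ f ∈ {f | f ∈ C}, {y | 0 < polyValue f y} := by
    ext y; simp [semialgOpen]
  rw [h]
  refine isOpen_biUnion fun C _ => Set.Finite.isOpen_biInter (List.finite_toSet C) fun f _ => ?_
  exact isOpen_lt continuous_const (continuous_polyValue f)

/-! ### Turing complete vector fields -/

/-- The orbit through `p` of a vector field `X` on `M ⊆ ℝᵐ`: all points reached, in positive or
negative time, by integral curves in `M` that start at `p` and are defined on an open interval. -/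
def orbit {m : ℕ} (M : Set (EuclideanSpace ℝ (Fin m)))
    (X : EuclideanSpace ℝ (Fin m) → EuclideanSpace ℝ (Fin m)) (p : EuclideanSpace ℝ (Fin m)) :
    Set (EuclideanSpace ℝ (Fin m)) :=
  {y | ∃ (γ : ℝ → EuclideanSpace ℝ (Fin m)) (I : Set ℝ), IsOpen I ∧ I.OrdConnected ∧ 0 ∈ I ∧
    γ 0 = p ∧ Set.MapsTo γ I M ∧ IsIntegralCurveOn γ (fun _ => X) I ∧ y ∈ γ '' I}

/-- The vector field `X` on `M ⊆ ℝᵐ` is Turing complete: for every `k`, every Turing machine `T`,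
every input tape `t` (blank outside the positions `-k₀, …, k₀`) and every string `u` of `2k + 1`
symbols there are a point `p ∈ M` and an open set `U` of `M` such that the orbit of `X` through `p`
meets `U` if and only if `T` halts on input `t` with output `u` in the positions `-k, …, k`.
Here `p` and `U` are explicit: from the data `(T, t, u)` one algorithm computes the rational
coordinates of `p`, and another one a finite list of rational polynomials that defines `U`. -/
def TuringComplete {m : ℕ} (M : Set (EuclideanSpace ℝ (Fin m)))
    (X : EuclideanSpace ℝ (Fin m) → EuclideanSpace ℝ (Fin m)) : Prop :=
  ∃ (pointOf : List (List ℕ) → List (ℤ × ℕ)) (openOf : List (List ℕ) → List (List PolyWord)),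
    Computable pointOf ∧ Computable openOf ∧
    ∀ (k r s : ℕ), 2 ≤ s → ∀ (T : TuringMachine r s) (k₀ : ℕ) (t : ℤ → Fin s),
      (∀ i : ℤ, (k₀ : ℤ) < |i| → (t i : ℕ) = 0) →
      ∀ u : Fin (2 * k + 1) → Fin s,
        ratPoint m (pointOf (T.describe k₀ t k u)) ∈ M ∧
        ((orbit M X (ratPoint m (pointOf (T.describe k₀ t k u))) ∩
            (M ∩ semialgOpen m (openOf (T.describe k₀ t k u)))).Nonempty ↔
          T.HaltsWithOutput t k u)

/-! ### Polynomial vector fields -/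

/-- A polynomial vector field on `ℝᵐ`, given by its components. -/
abbrev PolyField (m : ℕ) : Type := Fin m → MvPolynomial (Fin m) ℝ

namespace PolyField

variable {m : ℕ}

/-- The vector field as a map. -/
noncomputable def toFun (P : PolyField m) (y : EuclideanSpace ℝ (Fin m)) :
    EuclideanSpace ℝ (Fin m) :=
  WithLp.toLp 2 fun i => MvPolynomial.eval (fun j => y j) (P i)

/-- The degree of a polynomial vector field is the largest degree of its components. -/
noncomputable def degree (P : PolyField m) : ℕ := Finset.univ.sup fun i => (P i).totalDegree

end PolyField

/-- `x` is a computable real number: an algorithm computes dyadic approximations of `x` to any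
given precision. -/
def IsComputableReal (x : ℝ) : Prop :=
  ∃ f : ℕ → ℤ, Computable f ∧ ∀ k : ℕ, |x - (f k : ℝ) / 2 ^ k| ≤ 1 / 2 ^ k

/-- A polynomial vector field is constructible if all its coefficients are computable reals. -/
def PolyField.Constructible {m : ℕ} (P : PolyField m) : Prop :=
  ∀ (i : Fin m) (e : Fin m →₀ ℕ), IsComputableReal ((P i).coeff e)

/-! ### The sphere -/

/-- The unit sphere `𝕊ⁿ ⊆ ℝⁿ⁺¹`. -/
def unitSphere (n : ℕ) : Set (EuclideanSpace ℝ (Fin (n + 1))) := Metric.sphere 0 1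

/-- The north pole `(1, 0, …, 0)`. -/
noncomputable def northPole (n : ℕ) : EuclideanSpace ℝ (Fin (n + 1)) := EuclideanSpace.single 0 1

/-- The inverse stereographic projection `ℝⁿ → 𝕊ⁿ`,
`x ↦ ((r² - 1) / (1 + r²), 2 x₁ / (1 + r²), …, 2 xₙ / (1 + r²))` with `r = |x|`. -/
noncomputable def invStereo (n : ℕ) (x : EuclideanSpace ℝ (Fin n)) :
    EuclideanSpace ℝ (Fin (n + 1)) :=
  WithLp.toLp 2 (Fin.cons ((‖x‖ ^ 2 - 1) / (1 + ‖x‖ ^ 2)) fun k => 2 * x k / (1 + ‖x‖ ^ 2))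

/-- The polynomial field `X` on `ℝⁿ⁺¹` is tangent to the unit sphere. -/
def PolyField.TangentToSphere {n : ℕ} (X : PolyField (n + 1)) : Prop :=
  ∀ y ∈ unitSphere n, inner ℝ y (X.toFun y) = 0

end SphereTC

/-! All computational content sits in one computable coefficient. Bounded simulation is decidable,
so there is a computable sequence `haltSeq`, with values in ℕ, in which the code `w = encode W + 1`
occurs exactly when the machine described by `W` halts with the required output. This sequence is
stored in the lacunary series α = ∑ d_j / D_j with D_j = `lacDen j` and D_{j+1} = D_j ^ 4; a
reference series β = ∑ 1 / D_j serves as a ruler. Both sums are computable reals. The field on ℝⁿ is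
a clock together with rotations of frequencies 1, β, α and a constant coordinate that holds `w`. Its
trajectories search all coefficients of α, so a single open set, the same for all inputs, can test
whether `w` occurs; the input enters only through the initial point.

Let Q = D_i. At time 2πQ the partial sums up to index i contribute whole turns, and the angles left
over are about 2π/Q³ for β and 2πd_{i+1}/Q³ for α. Hence sin(αt) ≈ w sin(βt) if d_{i+1} = w
(`accepts_of_lacDen`). The converse is a Diophantine argument in the manner of Legendre. Acceptance
forces t to lie near some 2πn for which βn exceeds an integer by a positive amount below 1/(32n²).
Such an n must be a multiple of a denominator D_i, because partial sums of β are reduced fractions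
and the next denominator is far away; the ratio of the two small angles is then close to the integer
d_{i+1}, hence equal to it (`exists_coeff_eq`, `Accepts.exists_coeff_eq`).

The passage to the sphere is algebraic. Under inverse stereographic projection y_k = (1 - y₀)x_k
with 1 - y₀ = 2/(1 + r²), so homogenizing with powers of 1 - y₀ clears denominators and gives the
polynomial field `sphereField`. The time change has speed bounded above, so complete trajectories
stay complete and keep their range; sign conditions on polynomials transfer because 1 - y₀ > 0. The
coordinate with derivative x ^ 56 is zero on all trajectories that are used and only fixes the
degrees 56 and 58. -/

namespace SphereTC

/-! ### Bounded simulation of Turing machines is primitive recursive -/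

/-- A configuration written with lists: the state, the cells `-1, -2, …` and the cells
`0, 1, 2, …`; cells beyond the lists are blank. -/
abbrev ListConfig : Type := ℕ × List ℕ × List ℕ

/-- One step of the machine with transition table `tab`, alphabet size `s` and halting state `h`,
on list configurations. -/
def listStep (tab : List ℕ) (s h : ℕ) (c : ListConfig) : ListConfig :=
  if c.1 = h then c
  else
    if tab.getD (3 * (c.1 * s + c.2.2.headI) + 2) 0 = 0 then
      (tab.getD (3 * (c.1 * s + c.2.2.headI)) 0, c.2.1.tail,
        c.2.1.headI :: tab.getD (3 * (c.1 * s + c.2.2.headI) + 1) 0 :: c.2.2.tail)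
    else if tab.getD (3 * (c.1 * s + c.2.2.headI) + 2) 0 = 1 then
      (tab.getD (3 * (c.1 * s + c.2.2.headI)) 0, c.2.1,
        tab.getD (3 * (c.1 * s + c.2.2.headI) + 1) 0 :: c.2.2.tail)
    else
      (tab.getD (3 * (c.1 * s + c.2.2.headI)) 0,
        tab.getD (3 * (c.1 * s + c.2.2.headI) + 1) 0 :: c.2.1, c.2.2.tail)

/-- The initial list configuration that belongs to the described data. -/
def listInit (W : List (List ℕ)) : ListConfig :=
  ((W.getD 0 []).getD 2 0,
    ((W.getD 2 []).take ((W.getD 2 []).length / 2)).reverse,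
    (W.getD 2 []).drop ((W.getD 2 []).length / 2))

/-- The list configuration reached after `j` steps. -/
def listRun (W : List (List ℕ)) (j : ℕ) : ListConfig :=
  (listStep (W.getD 1 []) ((W.getD 0 []).getD 1 0) ((W.getD 0 []).getD 3 0))^[j] (listInit W)

/-- The symbols in the positions `-k, …, k`. -/
def listWindow (k : ℕ) (c : ListConfig) : List ℕ :=
  ((List.range k).map fun i => c.2.1.getD (k - 1 - i) 0) ++
    (List.range (k + 1)).map fun i => c.2.2.getD i 0

/-- Does the described machine halt within `j` steps with the required output? -/
def haltsWithin (W : List (List ℕ)) (j : ℕ) : Bool :=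
  decide ((listRun W j).1 = (W.getD 0 []).getD 3 0 ∧
    listWindow ((W.getD 3 []).length / 2) (listRun W j) = W.getD 3 [])

theorem primrec_listStep :
    Primrec₂ fun (W : List (List ℕ)) (c : ListConfig) =>
      listStep (W.getD 1 []) ((W.getD 0 []).getD 1 0) ((W.getD 0 []).getD 3 0) c := by
  have hW : ∀ i : ℕ, Primrec fun x : List (List ℕ) × ListConfig => x.1.getD i [] := fun i =>
    (Primrec.list_getD []).comp Primrec.fst (Primrec.const i)
  have hg : ∀ i : ℕ, Primrec fun x : List (List ℕ) × ListConfig => (x.1.getD 0 []).getD i 0 :=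
    fun i => (Primrec.list_getD 0).comp (hW 0) (Primrec.const i)
  have hq : Primrec fun x : List (List ℕ) × ListConfig => x.2.1 := Primrec.fst.comp Primrec.snd
  have hL : Primrec fun x : List (List ℕ) × ListConfig => x.2.2.1 :=
    Primrec.fst.comp (Primrec.snd.comp Primrec.snd)
  have hR : Primrec fun x : List (List ℕ) × ListConfig => x.2.2.2 :=
    Primrec.snd.comp (Primrec.snd.comp Primrec.snd)
  have hidx : Primrec fun x : List (List ℕ) × ListConfig =>
      3 * (x.2.1 * (x.1.getD 0 []).getD 1 0 + x.2.2.2.headI) :=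
    Primrec.nat_mul.comp (Primrec.const 3)
      (Primrec.nat_add.comp (Primrec.nat_mul.comp hq (hg 1)) (Primrec.list_headI.comp hR))
  have htab : ∀ i : ℕ, Primrec fun x : List (List ℕ) × ListConfig =>
      (x.1.getD 1 []).getD (3 * (x.2.1 * (x.1.getD 0 []).getD 1 0 + x.2.2.2.headI) + i) 0 :=
    fun i => (Primrec.list_getD 0).comp (hW 1) (Primrec.nat_add.comp hidx (Primrec.const i))
  have htl := Primrec.list_tail.comp hR
  unfold listStep
  refine Primrec.ite (Primrec.eq.comp hq (hg 3)) Primrec.snd ?_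
  refine Primrec.ite (Primrec.eq.comp (htab 2) (Primrec.const 0)) ?_ ?_
  · exact Primrec.pair (htab 0) (Primrec.pair (Primrec.list_tail.comp hL)
      (Primrec.list_cons.comp (Primrec.list_headI.comp hL)
        (Primrec.list_cons.comp (htab 1) htl)))
  · refine Primrec.ite (Primrec.eq.comp (htab 2) (Primrec.const 1)) ?_ ?_
    · exact Primrec.pair (htab 0) (Primrec.pair hL (Primrec.list_cons.comp (htab 1) htl))
    · exact Primrec.pair (htab 0) (Primrec.pair (Primrec.list_cons.comp (htab 1) hL) htl)

theorem primrec_listRun : Primrec₂ listRun := by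
  have hW : ∀ i : ℕ, Primrec fun W : List (List ℕ) => W.getD i [] := fun i =>
    (Primrec.list_getD []).comp Primrec.id (Primrec.const i)
  have hlen : Primrec fun W : List (List ℕ) => (W.getD 2 []).length / 2 :=
    Primrec.nat_div.comp (Primrec.list_length.comp (hW 2)) (Primrec.const 2)
  have hinit : Primrec listInit :=
    Primrec.pair ((Primrec.list_getD 0).comp (hW 0) (Primrec.const 2))
      (Primrec.pair (Primrec.list_reverse.comp (Primrec.list_take.comp hlen (hW 2)))
        (Primrec.list_drop.comp hlen (hW 2)))
  exact Primrec.nat_iterate Primrec.snd (hinit.comp Primrec.fst)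
    (primrec_listStep.comp (Primrec.fst.comp Primrec.fst) Primrec.snd)

theorem primrec_listWindow : Primrec₂ listWindow := by
  have hk : Primrec fun x : (ℕ × ListConfig) × ℕ => x.1.1 := Primrec.fst.comp Primrec.fst
  refine Primrec.list_append.comp
    (Primrec.list_map (Primrec.list_range.comp Primrec.fst) ?_)
    (Primrec.list_map (Primrec.list_range.comp (Primrec.succ.comp Primrec.fst)) ?_)
  · exact (Primrec.list_getD 0).comp
      (Primrec.fst.comp (Primrec.snd.comp (Primrec.snd.comp Primrec.fst)))
      (Primrec.nat_sub.comp (Primrec.nat_sub.comp hk (Primrec.const 1)) Primrec.snd)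
  · exact (Primrec.list_getD 0).comp
      (Primrec.snd.comp (Primrec.snd.comp (Primrec.snd.comp Primrec.fst))) Primrec.snd

/-- Only the simulation with a step bound has to be computable. The unbounded search over the number
of steps is left to the orbit. -/
theorem primrec_haltsWithin : Primrec₂ haltsWithin := by
  have hW : ∀ i : ℕ, Primrec fun x : List (List ℕ) × ℕ => x.1.getD i [] := fun i =>
    (Primrec.list_getD []).comp Primrec.fst (Primrec.const i)
  have hrun : Primrec fun x : List (List ℕ) × ℕ => listRun x.1 x.2 := primrec_listRun
  have h1 : PrimrecPred fun x : List (List ℕ) × ℕ =>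
      (listRun x.1 x.2).1 = (x.1.getD 0 []).getD 3 0 :=
    Primrec.eq.comp (Primrec.fst.comp hrun) ((Primrec.list_getD 0).comp (hW 0) (Primrec.const 3))
  have h2 : PrimrecPred fun x : List (List ℕ) × ℕ =>
      listWindow ((x.1.getD 3 []).length / 2) (listRun x.1 x.2) = x.1.getD 3 [] :=
    Primrec.eq.comp (primrec_listWindow.comp
      (Primrec.nat_div.comp (Primrec.list_length.comp (hW 3)) (Primrec.const 2)) hrun) (hW 3)
  exact (h1.and h2).decide

theorem getD_flatten_ofFn {α : Type*} {r m : ℕ} (f : Fin r → List α)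
    (hf : ∀ i, (f i).length = m) (i : Fin r) {j : ℕ} (hj : j < m) (d : α) :
    (List.ofFn f).flatten.getD (i * m + j) d = (f i).getD j d := by
  induction r with
  | zero => exact i.elim0
  | succ r ih =>
    rw [List.ofFn_succ, List.flatten_cons]
    refine Fin.cases ?_ (fun i => ?_) i
    · rw [List.getD_append _ _ _ _ (by simp [hf, hj])]
      simp
    · rw [List.getD_append_right _ _ _ _ (by rw [hf, Fin.val_succ]; nlinarith), hf,
        ← ih (fun i => f i.succ) (fun i => hf _) i]
      congr 1
      rw [Fin.val_succ, add_mul, one_mul]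
      omega

/-! ### List configurations follow the machine -/

namespace TuringMachine

variable {r s : ℕ}

theorem getD_table (T : TuringMachine r s) (q : Fin r) (a : Fin s) {e : ℕ} (he : e < 3) :
    T.table.getD (3 * (q * s + a) + e) 0 =
      [((T.δ q a).1 : ℕ), ((T.δ q a).2.1 : ℕ), (((T.δ q a).2.2 : ℤ) + 1).toNat].getD e 0 := by
  have h : 3 * ((q : ℕ) * s + a) + e = q * (s * 3) + (a * 3 + e) := by ring
  have ha : (a : ℕ) * 3 + e < s * 3 := by have := a.2; omega
  rw [h, table, getD_flatten_ofFn _ (fun i => ?_) q ha,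
    getD_flatten_ofFn _ (fun i => ?_) a he]
  · rfl
  · simp [List.length_flatten, Function.comp_def]

/-- The list configuration `c` represents the configuration `C`. -/
def Represents (c : ListConfig) (C : Fin r × (ℤ → Fin s)) : Prop :=
  c.1 = C.1 ∧ (∀ n : ℕ, c.2.1.getD n 0 = C.2 (-(n + 1))) ∧ ∀ n : ℕ, c.2.2.getD n 0 = C.2 n

theorem Represents.step {T : TuringMachine r s} {c : ListConfig} {C : Fin r × (ℤ → Fin s)}
    (h : Represents c C) : Represents (listStep T.table s T.halt c) (T.step C) := by
  obtain ⟨q, L, R⟩ := c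
  obtain ⟨q', t⟩ := C
  obtain ⟨h1, h2, h3⟩ := h
  simp only at h1 h2 h3
  subst h1
  -- For an empty list `headI` and `getD` both return 0, the blank symbol, so unlisted cells are
  -- read correctly.
  have hhead : R.headI = t 0 := by
    have := h3 0
    cases R <;> simpa using this
  have hheadL : L.headI = t (-1) := by
    have := h2 0
    cases L <;> simpa using this
  have htail : ∀ n : ℕ, R.tail.getD n 0 = t (n + 1) := fun n => by
    have := h3 (n + 1)
    cases R <;> simpa using this
  have htailL : ∀ n : ℕ, L.tail.getD n 0 = t (-(n + 2)) := fun n => by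
    have := h2 (n + 1)
    rw [show (-((n : ℤ) + 2)) = -(((n + 1 : ℕ) : ℤ) + 1) by push_cast; ring]
    cases L <;> simpa using this
  have hne : ∀ n : ℕ, ((n : ℤ) + 1) ≠ 0 := fun n => by omega
  have hne' : ∀ n : ℕ, -((n : ℤ) + 1) ≠ 0 := fun n => by omega
  unfold listStep TuringMachine.step
  by_cases hq : q' = T.halt
  · simp only [hq, if_true]
    exact ⟨rfl, h2, h3⟩
  have hq2 : ¬ ((q' : ℕ) = T.halt) := fun h => hq (Fin.ext h)
  have e0 := T.getD_table q' (t 0) (e := 0) (by norm_num)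
  have e1 := T.getD_table q' (t 0) (e := 1) (by norm_num)
  have e2 := T.getD_table q' (t 0) (e := 2) (by norm_num)
  simp only [add_zero] at e0
  simp only [hq, hq2, if_false, hhead]
  rw [e0, e1, e2]
  generalize T.δ q' (t 0) = a
  obtain ⟨a1, a2, a3⟩ := a
  have hu0 : Function.update t 0 a2 0 = a2 := Function.update_self ..
  have hu : ∀ m m' : ℤ, m = m' → m' ≠ 0 → Function.update t 0 a2 m = t m' := fun m m' h h' => by
    rw [h, Function.update_of_ne h']
  -- The constructors of `SignType` come in the order zero, neg, pos.
  rcases a3 with _ | _ | _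
  · refine ⟨rfl, fun n => ?_, fun n => ?_⟩
    · exact (h2 n).trans (congrArg Fin.val (hu _ _ (by simp) (by omega))).symm
    · rcases n with _ | n
      · exact (congrArg Fin.val hu0).symm
      · exact (htail n).trans (congrArg Fin.val (hu _ _ (by simp) (by omega))).symm
  · refine ⟨rfl, fun n => ?_, fun n => ?_⟩
    · exact (htailL n).trans (congrArg Fin.val (hu _ _
        (by change -((n : ℤ) + 1) + -1 = _; ring) (by omega))).symm
    · rcases n with _ | _ | n
      · exact hheadL.trans (congrArg Fin.val (hu _ _ (by simp) (by omega))).symm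
      · exact (congrArg Fin.val hu0).symm
      · exact (htail n).trans (congrArg Fin.val (hu _ _
          (by change ((n + 1 + 1 : ℕ) : ℤ) + -1 = _; push_cast; ring) (by omega))).symm
  · refine ⟨rfl, fun n => ?_, fun n => ?_⟩
    · rcases n with _ | n
      · exact (congrArg Fin.val hu0).symm
      · exact (h2 n).trans (congrArg Fin.val (hu _ _
          (by change -(((n + 1 : ℕ) : ℤ) + 1) + 1 = _; push_cast; ring) (by omega))).symm
    · exact (htail n).trans (congrArg Fin.val (hu _ _ rfl (by omega))).symm

theorem Represents.iterate {T : TuringMachine r s} {c : ListConfig} {C : Fin r × (ℤ → Fin s)}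
    (h : Represents c C) (j : ℕ) :
    Represents ((listStep T.table s T.halt)^[j] c) (T.step^[j] C) := by
  induction j with
  | zero => exact h
  | succ j ih =>
    rw [Function.iterate_succ_apply', Function.iterate_succ_apply']
    exact ih.step

theorem represents_listInit (T : TuringMachine r s) (k₀ : ℕ) (t : ℤ → Fin s)
    (ht : ∀ i : ℤ, (k₀ : ℤ) < |i| → (t i : ℕ) = 0) (k : ℕ) (u : Fin (2 * k + 1) → Fin s) :
    Represents (listInit (T.describe k₀ t k u)) (T.start, t) := by
  have hlen : (2 * k₀ + 1) / 2 = k₀ := by omega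
  have hw : ∀ j : ℕ, j < 2 * k₀ + 1 → (List.ofFn fun i : Fin (2 * k₀ + 1) =>
      (t ((i : ℤ) - k₀) : ℕ))[j]? = some (t ((j : ℤ) - k₀) : ℕ) := fun j hj => by
    rw [List.getElem?_ofFn, dif_pos hj]
  have hw' : ∀ j : ℕ, 2 * k₀ + 1 ≤ j → (List.ofFn fun i : Fin (2 * k₀ + 1) =>
      (t ((i : ℤ) - k₀) : ℕ))[j]? = none := fun j hj => by
    rw [List.getElem?_ofFn, dif_neg (by omega)]
  refine ⟨rfl, fun n => ?_, fun n => ?_⟩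
  · simp only [listInit, describe, List.getD_eq_getElem?_getD, List.getElem?_cons_succ,
      List.getElem?_cons_zero, Option.getD_some, List.length_ofFn, hlen]
    rcases lt_or_ge n k₀ with h | h
    · rw [List.getElem?_reverse (by simp; omega), List.getElem?_take_of_lt (by simp; omega), hw]
      · simp only [List.length_take, List.length_ofFn, Option.getD_some]
        congr 2
        have : min k₀ (2 * k₀ + 1) = k₀ := by omega
        rw [this]
        omega
      · simp
    · rw [List.getElem?_eq_none (by simp; omega), ht _ (by rw [abs_neg, abs_of_nonneg] <;> omega)]
      rfl
  · simp only [listInit, describe, List.getD_eq_getElem?_getD, List.getElem?_cons_succ,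
      List.getElem?_cons_zero, Option.getD_some, List.length_ofFn, hlen, List.getElem?_drop]
    rcases le_or_gt n k₀ with h | h
    · rw [hw _ (by omega)]
      simp
    · rw [hw' _ (by omega), ht _ (by rw [abs_of_nonneg] <;> omega)]
      rfl

theorem listWindow_eq_iff {c : ListConfig} {C : Fin r × (ℤ → Fin s)} (h : Represents c C)
    (k : ℕ) (u : Fin (2 * k + 1) → Fin s) :
    listWindow k c = (List.ofFn fun i => (u i : ℕ)) ↔
      ∀ i : Fin (2 * k + 1), C.2 ((i : ℤ) - k) = u i := by
  have key : listWindow k c = List.ofFn fun i : Fin (2 * k + 1) => (C.2 ((i : ℤ) - k) : ℕ) := by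
    refine List.ext_getElem (by simp [listWindow]; omega) fun i hi hi' => ?_
    simp only [listWindow, List.getElem_ofFn]
    rcases lt_or_ge i k with hk | hk
    · rw [List.getElem_append_left (by simpa using hk), List.getElem_map, List.getElem_range,
        h.2.1]
      refine congrArg (fun m => (C.2 m : ℕ)) ?_
      omega
    · rw [List.getElem_append_right (by simpa using hk), List.getElem_map, List.getElem_range,
        h.2.2]
      refine congrArg (fun m => (C.2 m : ℕ)) ?_
      simp only [List.length_map, List.length_range]
      omega
  rw [key, List.ofFn_inj, funext_iff]
  exact forall_congr' fun i => Fin.val_inj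

theorem exists_haltsWithin_describe_iff (T : TuringMachine r s) (k₀ : ℕ) (t : ℤ → Fin s)
    (ht : ∀ i : ℤ, (k₀ : ℤ) < |i| → (t i : ℕ) = 0) (k : ℕ) (u : Fin (2 * k + 1) → Fin s) :
    (∃ j, haltsWithin (T.describe k₀ t k u) j = true) ↔ T.HaltsWithOutput t k u := by
  refine exists_congr fun j => ?_
  have h : Represents (listRun (T.describe k₀ t k u) j) (T.step^[j] (T.start, t)) :=
    (represents_listInit T k₀ t ht k u).iterate j
  have hlen : ((T.describe k₀ t k u).getD 3 []).length / 2 = k := by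
    simp [describe]
    omega
  rw [haltsWithin, decide_eq_true_iff, hlen]
  refine and_congr ?_ (listWindow_eq_iff h k u)
  rw [h.1]
  exact Fin.val_inj

end TuringMachine

end SphereTC

namespace SphereTC

/-! ### Computable integers and computable reals -/

/-- The encoding of ℤ sends `Int.ofNat n` to 2n and `Int.negSucc n` to 2n + 1. Addition and negation
of integers reduce to this map by writing z = `z.toNat` - `(-z).toNat`. -/
theorem primrec_natSub_int : Primrec₂ fun a b : ℕ => (a : ℤ) - (b : ℤ) := by
  have h : Primrec fun x : ℕ × ℕ => if x.2 ≤ x.1 then 2 * (x.1 - x.2) else 2 * (x.2 - x.1 - 1) + 1 :=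
    Primrec.ite (Primrec.nat_le.comp Primrec.snd Primrec.fst)
      (Primrec.nat_double.comp (Primrec.nat_sub.comp Primrec.fst Primrec.snd))
      (Primrec.nat_double_succ.comp (Primrec.nat_sub.comp
        (Primrec.nat_sub.comp Primrec.snd Primrec.fst) (Primrec.const 1)))
  refine Primrec.encode_iff.1 (h.of_eq fun x => ?_)
  beta_reduce
  split_ifs with hx
  · obtain ⟨d, hd⟩ := Nat.exists_eq_add_of_le hx
    rw [show (x.1 : ℤ) - x.2 = Int.ofNat d by rw [hd]; simp, hd, Nat.add_sub_cancel_left]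
    rfl
  · obtain ⟨d, hd⟩ := Nat.exists_eq_add_of_lt (not_le.1 hx)
    rw [show (x.1 : ℤ) - x.2 = Int.negSucc d by rw [hd, Int.negSucc_eq]; push_cast; ring,
      show x.2 - x.1 - 1 = d by omega]
    rfl

theorem primrec_int_natCast : Primrec fun n : ℕ => (n : ℤ) :=
  (primrec_natSub_int.comp Primrec.id (Primrec.const 0)).of_eq fun n => by simp

theorem primrec_int_toNat : Primrec Int.toNat := by
  have h : Primrec fun z : ℤ => if Encodable.encode z % 2 = 0 then Encodable.encode z / 2 else 0 :=
    Primrec.ite (Primrec.eq.comp (Primrec.nat_mod.comp Primrec.encode (Primrec.const 2))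
      (Primrec.const 0)) (Primrec.nat_div.comp Primrec.encode (Primrec.const 2)) (Primrec.const 0)
  refine h.of_eq fun z => ?_
  rcases z with n | n
  · rw [show Encodable.encode (Int.ofNat n) = 2 * n from rfl]
    simp
  · rw [show Encodable.encode (Int.negSucc n) = 2 * n + 1 from rfl, if_neg (by omega)]
    rfl

theorem primrec_int_neg_toNat : Primrec fun z : ℤ => (-z).toNat := by
  have h : Primrec fun z : ℤ =>
      if Encodable.encode z % 2 = 0 then 0 else Encodable.encode z / 2 + 1 :=
    Primrec.ite (Primrec.eq.comp (Primrec.nat_mod.comp Primrec.encode (Primrec.const 2))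
      (Primrec.const 0)) (Primrec.const 0)
      (Primrec.succ.comp (Primrec.nat_div.comp Primrec.encode (Primrec.const 2)))
  refine h.of_eq fun z => ?_
  rcases z with n | n
  · rw [show Encodable.encode (Int.ofNat n) = 2 * n from rfl]
    simp
  · rw [show Encodable.encode (Int.negSucc n) = 2 * n + 1 from rfl, if_neg (by omega)]
    simp
    omega

theorem primrec_int_add : Primrec₂ fun a b : ℤ => a + b :=
  (primrec_natSub_int.comp
    (Primrec.nat_add.comp (primrec_int_toNat.comp Primrec.fst) (primrec_int_toNat.comp Primrec.snd))
    (Primrec.nat_add.comp (primrec_int_neg_toNat.comp Primrec.fst)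
      (primrec_int_neg_toNat.comp Primrec.snd))).of_eq fun x => by
    have h1 := Int.toNat_sub_toNat_neg x.1
    have h2 := Int.toNat_sub_toNat_neg x.2
    push_cast
    linarith

theorem primrec_int_neg : Primrec fun a : ℤ => -a :=
  (primrec_natSub_int.comp primrec_int_neg_toNat primrec_int_toNat).of_eq fun x => by
    have h1 := Int.toNat_sub_toNat_neg x
    linarith

/-- Division rounds down, so it keeps the constructor of the integer and divides its natural
argument by 4. On codes, the parity bit stays and the half is divided. -/
theorem primrec_int_div_four : Primrec fun a : ℤ => a / 4 := by
  have h : Primrec fun z : ℤ => 2 * (Encodable.encode z / 2 / 4) + Encodable.encode z % 2 :=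
    Primrec.nat_add.comp
      (Primrec.nat_double.comp (Primrec.nat_div.comp
        (Primrec.nat_div.comp Primrec.encode (Primrec.const 2)) (Primrec.const 4)))
      (Primrec.nat_mod.comp Primrec.encode (Primrec.const 2))
  refine Primrec.encode_iff.1 (h.of_eq fun z => ?_)
  rcases z with n | n
  · rw [show Encodable.encode (Int.ofNat n) = 2 * n from rfl,
      show Int.ofNat n / 4 = Int.ofNat (n / 4) from rfl,
      show Encodable.encode (Int.ofNat (n / 4)) = 2 * (n / 4) from rfl]
    omega
  · rw [show Encodable.encode (Int.negSucc n) = 2 * n + 1 from rfl,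
      show Int.negSucc n / 4 = Int.negSucc (n / 4) from rfl,
      show Encodable.encode (Int.negSucc (n / 4)) = 2 * (n / 4) + 1 from rfl]
    omega

namespace IsComputableReal

theorem natCast (n : ℕ) : IsComputableReal n := by
  refine ⟨fun k => ((n * 2 ^ k : ℕ) : ℤ), ?_, fun k => ?_⟩
  · have h : Primrec fun k : ℕ => 2 ^ k :=
      (Primrec.nat_iterate (h := fun _ y => 2 * y) Primrec.id (Primrec.const 1)
        (Primrec.nat_double.comp Primrec.snd)).of_eq fun k => by
        simp
    exact (primrec_int_natCast.comp (Primrec.nat_mul.comp (Primrec.const n) h)).to_comp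
  · have : (2 : ℝ) ^ k ≠ 0 := by positivity
    push_cast
    rw [mul_div_assoc, div_self this]
    simp

theorem zero : IsComputableReal 0 := by simpa using natCast 0

theorem one : IsComputableReal 1 := by simpa using natCast 1

theorem neg {x : ℝ} (hx : IsComputableReal x) : IsComputableReal (-x) := by
  obtain ⟨f, hf, h⟩ := hx
  refine ⟨fun k => -f k, primrec_int_neg.to_comp.comp hf, fun k => ?_⟩
  rw [← abs_neg]
  convert h k using 2
  push_cast
  ring

theorem add {x y : ℝ} (hx : IsComputableReal x) (hy : IsComputableReal y) :
    IsComputableReal (x + y) := by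
  obtain ⟨f, hf, h⟩ := hx
  obtain ⟨g, hg, h'⟩ := hy
  -- The two approximations contribute at most half a unit of 2^(-k). Adding 2 before the division
  -- by 4 rounds to a nearest integer and costs at most another half.
  refine ⟨fun k => (f (k + 2) + g (k + 2) + 2) / 4, ?_, fun k => ?_⟩
  · have h2 : Computable fun k : ℕ => k + 2 :=
      (Primrec.nat_add.comp Primrec.id (Primrec.const 2)).to_comp
    exact primrec_int_div_four.to_comp.comp
      (primrec_int_add.to_comp.comp (primrec_int_add.to_comp.comp (hf.comp h2) (hg.comp h2))
        (Computable.const 2))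
  · beta_reduce
    have h1 := abs_le.1 (h (k + 2))
    have h2 := abs_le.1 (h' (k + 2))
    generalize f (k + 2) = a at *
    generalize g (k + 2) = b at *
    have h3 := Int.emod_add_mul_ediv (a + b + 2) 4
    have h4 := Int.emod_nonneg (a + b + 2) (by norm_num : (4 : ℤ) ≠ 0)
    have h5 : (a + b + 2) % 4 ≤ 3 := by omega
    generalize (a + b + 2) / 4 = c at *
    generalize (a + b + 2) % 4 = e at *
    have h3' : (e : ℝ) + 4 * c = a + b + 2 := by exact_mod_cast h3
    have h4' : (0 : ℝ) ≤ e := by exact_mod_cast h4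
    have h5' : (e : ℝ) ≤ 3 := by exact_mod_cast h5
    have hp : (0 : ℝ) < 2 ^ k := by positivity
    rw [pow_add] at h1 h2
    have e1 : ∀ z : ℝ, z / ((2 : ℝ) ^ k * 2 ^ 2) = z / 2 ^ k / 4 := fun z => by
      rw [div_div]; norm_num
    rw [e1, e1] at h1 h2
    have hc : (c : ℝ) / 2 ^ k
        = ((a : ℝ) / 2 ^ k + b / 2 ^ k + 2 * (1 / 2 ^ k) - e * (1 / 2 ^ k)) / 4 := by
      field_simp
      linarith
    rw [hc]
    have hq : (0 : ℝ) < 1 / 2 ^ k := by positivity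
    generalize (1 : ℝ) / 2 ^ k = δ at *
    have h6 : 0 ≤ e * δ := by positivity
    have h7 : e * δ ≤ 3 * δ := by nlinarith
    rw [abs_le]
    constructor <;> linarith

end IsComputableReal

/-! ### Lacunary series -/

/-- The denominators `2 ^ 4 ^ (i + 1)`. -/
def lacDen (i : ℕ) : ℕ := 2 ^ 4 ^ (i + 1)

/-- The numerator of the partial sum `∑ j ≤ k, c j / lacDen j` over the denominator `lacDen k`. -/
def lacNum (c : ℕ → ℕ) (k : ℕ) : ℕ :=
  Nat.rec (c 0) (fun k A => A * lacDen k ^ 3 + c (k + 1)) k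

/-- The number `∑ j, c j / lacDen j`. -/
noncomputable def lacSum (c : ℕ → ℕ) : ℝ := ∑' j, (c j : ℝ) / lacDen j

/-- The tail `∑ j ≥ i, c j / lacDen j`. -/
noncomputable def lacTail (c : ℕ → ℕ) (i : ℕ) : ℝ := ∑' j, (c (i + j) : ℝ) / lacDen (i + j)

theorem lacDen_pos (i : ℕ) : 0 < lacDen i := by unfold lacDen; positivity

theorem lacDen_succ (i : ℕ) : lacDen (i + 1) = lacDen i ^ 4 := by
  unfold lacDen
  rw [← pow_mul, pow_succ 4 (i + 1)]

/-- In the exponent, 4 · 4^(i+l+1) dominates (i+l+1) + (l+1) + 2 · 4^(i+1) term by term.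
Consequently, if c j ≤ j + 1, the terms after index i lie below a geometric series with sum 1 /
`lacDen i` ^ 2. -/
theorem lacDen_bound (i l : ℕ) :
    (i + l + 2) * 2 ^ (l + 1) * lacDen i ^ 2 ≤ lacDen (i + 1 + l) := by
  have h1 : i + l + 2 ≤ 2 ^ (i + l + 1) := Nat.lt_two_pow_self
  have h2 : i + l + 1 < 4 ^ (i + l + 1) := Nat.lt_pow_self (by norm_num)
  have h3 : 4 ^ (i + 1) ≤ 4 ^ (i + l + 1) := Nat.pow_le_pow_right (by norm_num) (by omega)
  calc (i + l + 2) * 2 ^ (l + 1) * lacDen i ^ 2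
      ≤ 2 ^ (i + l + 1) * 2 ^ (l + 1) * lacDen i ^ 2 := by gcongr
    _ = 2 ^ ((i + l + 1) + (l + 1) + 4 ^ (i + 1) * 2) := by
        rw [lacDen, ← pow_mul, ← pow_add, ← pow_add]
    _ ≤ lacDen (i + 1 + l) := by
        rw [lacDen]
        refine Nat.pow_le_pow_right (by norm_num) ?_
        rw [show i + 1 + l + 1 = (i + l + 1) + 1 by ring, pow_succ]
        omega

section

variable {c : ℕ → ℕ}

theorem lac_term_le (hc : ∀ j, c j ≤ j + 1) (i l : ℕ) :
    (c (i + 1 + l) : ℝ) / lacDen (i + 1 + l) ≤ (1 / (lacDen i : ℝ) ^ 2) * (1 / 2) ^ (l + 1) := by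
  have h := lacDen_bound i l
  have h' : c (i + 1 + l) ≤ i + l + 2 := by have := hc (i + 1 + l); omega
  have hp : (0 : ℝ) < lacDen (i + 1 + l) := by exact_mod_cast lacDen_pos _
  have hp' : (0 : ℝ) < lacDen i := by exact_mod_cast lacDen_pos _
  rw [one_div_pow, one_div_mul_one_div, div_le_div_iff₀ hp (by positivity), one_mul]
  have : c (i + 1 + l) * (lacDen i ^ 2 * 2 ^ (l + 1)) ≤ lacDen (i + 1 + l) := by
    refine le_trans ?_ h
    calc c (i + 1 + l) * (lacDen i ^ 2 * 2 ^ (l + 1))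
        ≤ (i + l + 2) * (lacDen i ^ 2 * 2 ^ (l + 1)) := by gcongr
      _ = _ := by ring
  exact_mod_cast this

theorem summable_lac (hc : ∀ j, c j ≤ j + 1) (i : ℕ) :
    Summable fun j => (c (i + j) : ℝ) / lacDen (i + j) := by
  have hg : Summable fun l : ℕ => (1 / (lacDen i : ℝ) ^ 2) * (1 / 2 : ℝ) ^ (l + 1) :=
    ((summable_nat_add_iff 1).2 summable_geometric_two).mul_left _
  have := Summable.of_nonneg_of_le (fun l => by positivity) (lac_term_le hc i) hg
  rw [← summable_nat_add_iff 1]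
  refine this.congr fun l => ?_
  rw [show i + (l + 1) = i + 1 + l by ring]

theorem lacTail_eq (hc : ∀ j, c j ≤ j + 1) (i : ℕ) :
    lacTail c i = c i / lacDen i + lacTail c (i + 1) := by
  unfold lacTail
  rw [(summable_lac hc i).tsum_eq_zero_add]
  simp only [add_zero]
  congr 2
  ext l
  rw [show i + (l + 1) = i + 1 + l by ring]

theorem lacTail_nonneg (i : ℕ) : 0 ≤ lacTail c i := tsum_nonneg fun _ => by positivity

theorem lacTail_succ_le (hc : ∀ j, c j ≤ j + 1) (i : ℕ) :
    lacTail c (i + 1) ≤ 1 / (lacDen i : ℝ) ^ 2 := by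
  have hg : HasSum (fun l : ℕ => (1 / (lacDen i : ℝ) ^ 2) * (1 / 2 : ℝ) ^ (l + 1))
      (1 / (lacDen i : ℝ) ^ 2) := by
    have h : HasSum (fun l : ℕ => (1 / 2 : ℝ) ^ (l + 1)) 1 := by
      convert hasSum_geometric_two' (1 : ℝ) using 2 with l
      rw [pow_succ, one_div_pow]
      ring
    simpa only [mul_one] using h.mul_left (1 / (lacDen i : ℝ) ^ 2)
  exact hasSum_le (lac_term_le hc i) (summable_lac hc (i + 1)).hasSum hg

theorem lacSum_eq (hc : ∀ j, c j ≤ j + 1) (k : ℕ) :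
    lacSum c = lacNum c k / lacDen k + lacTail c (k + 1) := by
  induction k with
  | zero =>
    rw [show lacNum c 0 = c 0 from rfl, ← lacTail_eq hc, lacSum, lacTail]
    simp
  | succ k ih =>
    have hp' : (lacDen k : ℝ) ≠ 0 := by exact_mod_cast (lacDen_pos _).ne'
    rw [ih, lacTail_eq hc (k + 1), show lacNum c (k + 1) = lacNum c k * lacDen k ^ 3 + c (k + 1)
      from rfl, lacDen_succ]
    push_cast
    field_simp
    ring

theorem isComputableReal_lacSum (hc : ∀ j, c j ≤ j + 1) (h : Computable c) :
    IsComputableReal (lacSum c) := by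
  have hpow : ∀ b : ℕ, Primrec fun k : ℕ => b ^ k := fun b =>
    (Primrec.nat_iterate (h := fun _ y => b * y) Primrec.id (Primrec.const 1)
      (Primrec.nat_mul.comp (Primrec.const b) Primrec.snd)).of_eq fun k => by simp
  have hden : Primrec lacDen := (hpow 2).comp ((hpow 4).comp Primrec.succ)
  have hnum : Computable (lacNum c) := by
    refine Computable.nat_rec (f := fun k : ℕ => k) (g := fun _ => c 0)
      (h := fun _ (p : ℕ × ℕ) => p.2 * lacDen p.1 ^ 3 + c (p.1 + 1)) Computable.id
      (Computable.const _) ?_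
    have h3 : Primrec fun x : ℕ => x ^ 3 :=
      (Primrec.nat_mul.comp (Primrec.nat_mul.comp Primrec.id Primrec.id) Primrec.id).of_eq
        fun x => by simp only [id]; ring
    have hd : Primrec fun p : ℕ × ℕ × ℕ => lacDen p.2.1 ^ 3 :=
      h3.comp (hden.comp (Primrec.fst.comp Primrec.snd))
    exact Primrec.nat_add.to_comp.comp
      (Primrec.nat_mul.to_comp.comp (Computable.snd.comp Computable.snd) hd.to_comp)
      (h.comp (Computable.succ.comp (Computable.fst.comp Computable.snd)))
  -- With `lacDen k` = 2^k m, rounding down loses at most (m - 1)/(2^k m). The remaining margin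
  -- 1/(2^k m) absorbs the tail, which is at most its square.
  refine ⟨fun k => ((lacNum c k * 2 ^ k / lacDen k : ℕ) : ℤ), ?_, fun k => ?_⟩
  · exact primrec_int_natCast.to_comp.comp (Primrec.nat_div.to_comp.comp
      (Primrec.nat_mul.to_comp.comp hnum (hpow 2).to_comp) hden.to_comp)
  · have hle : 2 ^ k ≤ lacDen k := Nat.pow_le_pow_right (by norm_num)
      (by have : k + 1 < 4 ^ (k + 1) := Nat.lt_pow_self (by norm_num)
          omega)
    have hdvd : 2 ^ k ∣ lacDen k := Nat.pow_dvd_pow 2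
      (by have : k + 1 < 4 ^ (k + 1) := Nat.lt_pow_self (by norm_num)
          omega)
    obtain ⟨m, hm⟩ := hdvd
    have hmpos : 0 < m := Nat.pos_of_ne_zero fun h0 => by
      have := lacDen_pos k
      rw [hm, h0] at this
      simp at this
    have hdiv : lacNum c k * 2 ^ k / lacDen k = lacNum c k / m := by
      rw [hm, mul_comm, Nat.mul_div_mul_left _ _ (by positivity)]
    beta_reduce
    rw [hdiv, lacSum_eq hc k, hm]
    have h1 := lacTail_succ_le hc k
    have h0 := lacTail_nonneg (c := c) (k + 1)
    have hdm := Nat.div_add_mod (lacNum c k) m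
    have hlt := Nat.mod_lt (lacNum c k) hmpos
    generalize lacNum c k / m = a at *
    generalize lacNum c k % m = e at *
    rw [← hdm]
    have hmR : (1 : ℝ) ≤ m := by exact_mod_cast hmpos
    have hp : (1 : ℝ) ≤ 2 ^ k := one_le_pow₀ (by norm_num)
    have heR : (e : ℝ) + 1 ≤ m := by exact_mod_cast hlt
    rw [hm] at h1
    push_cast at h1 ⊢
    have e1 : ((m : ℝ) * a + e) / (2 ^ k * m) - a / 2 ^ k = e / (2 ^ k * m) := by
      field_simp
      ring
    have e2 : 0 ≤ (e : ℝ) / (2 ^ k * m) := by positivity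
    have e3 : (e : ℝ) / (2 ^ k * m) + 1 / (2 ^ k * m) ≤ 1 / 2 ^ k := by
      rw [← add_div, div_le_div_iff₀ (by positivity) (by positivity)]
      nlinarith
    have e4 : 1 / ((2 : ℝ) ^ k * m) ^ 2 ≤ 1 / (2 ^ k * m) := by
      apply one_div_le_one_div_of_le (by positivity)
      have : (1 : ℝ) ≤ 2 ^ k * m := by nlinarith
      nlinarith
    rw [abs_le]
    constructor <;> linarith

end

end SphereTC

namespace SphereTC

/-! ### Reading off the coefficients of a lacunary series -/

theorem lacDen_zero : lacDen 0 = 16 := by norm_num [lacDen]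

theorem lacDen_strictMono : StrictMono lacDen := fun i j h =>
  Nat.pow_lt_pow_right (by norm_num) (Nat.pow_lt_pow_right (by norm_num) (by omega))

theorem add_four_le_lacDen (i : ℕ) : i + 4 ≤ lacDen i := by
  induction i with
  | zero => norm_num [lacDen_zero]
  | succ i ih => have : lacDen i < lacDen (i + 1) := lacDen_strictMono (Nat.lt_succ_self i); omega

theorem sixteen_le_lacDen (i : ℕ) : 16 ≤ lacDen i :=
  lacDen_zero ▸ lacDen_strictMono.monotone (Nat.zero_le i)

theorem exists_lacDen_le_lt {N : ℕ} (hN : 16 ≤ N) : ∃ i, lacDen i ≤ N ∧ N < lacDen (i + 1) := by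
  have hex : ∃ i, N < lacDen i := ⟨N, by have := add_four_le_lacDen N; omega⟩
  classical
  obtain ⟨i, hi⟩ : ∃ i, Nat.find hex = i + 1 := Nat.exists_eq_succ_of_ne_zero fun h0 => by
    have := Nat.find_spec hex
    rw [h0, lacDen_zero] at this
    omega
  exact ⟨i, not_lt.1 (Nat.find_min hex (by omega)), hi ▸ Nat.find_spec hex⟩

/-- Each numerator is 1 or an even number plus 1, and the denominators are powers of two. The
reference series has all coefficients 1 precisely so that its partial sums are reduced fractions. -/
theorem coprime_lacNum_one (i : ℕ) : Nat.Coprime (lacNum (fun _ => 1) i) (lacDen i) := by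
  refine Nat.Coprime.pow_right _ ?_
  rcases i with _ | i
  · exact Nat.coprime_one_left _
  · rw [Nat.coprime_two_right]
    have h : Even (lacDen i) := (Nat.even_pow.2 ⟨even_two, by positivity⟩)
    exact ((h.pow_of_ne_zero three_ne_zero).mul_left _).add_one

theorem lacTail_bounds {c : ℕ → ℕ} (hc : ∀ j, c j ≤ j + 1) (i : ℕ) :
    ∃ r : ℝ, 0 ≤ r ∧ r ≤ 1 / (lacDen i : ℝ) ^ 8 ∧
      lacTail c (i + 1) = c (i + 1) / (lacDen i : ℝ) ^ 4 + r := by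
  refine ⟨lacTail c (i + 2), lacTail_nonneg _, ?_, ?_⟩
  · refine (lacTail_succ_le hc (i + 1)).trans (le_of_eq ?_)
    rw [lacDen_succ]
    push_cast
    ring
  · rw [lacTail_eq hc, lacDen_succ]
    push_cast
    ring

theorem lacSum_nonneg (c : ℕ → ℕ) : 0 ≤ lacSum c := tsum_nonneg fun _ => by positivity

theorem lacSum_le_one {c : ℕ → ℕ} (hc : ∀ j, c j ≤ j + 1) : lacSum c ≤ 1 := by
  have h := lacSum_eq hc 0
  have h1 := lacTail_succ_le hc 0
  have h2 : (c 0 : ℝ) ≤ 1 := by exact_mod_cast hc 0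
  rw [show lacNum c 0 = c 0 from rfl] at h
  rw [lacDen_zero] at h h1
  norm_num at h h1
  linarith

/-- Here u is 1/Q, and e u⁴ + r' and u⁴ + r are the tails of the two series. Since r, r' ≤ u⁸ and e
u ≤ 1, their ratio differs from e by a quantity of order u³. A tolerance of 3/4 around the integer w
therefore leaves only e = w. -/
theorem natCast_eq_of_tail_ratio {n u r r' : ℝ} {e w : ℕ} (hnpos : 0 < n) (hupos : 0 < u)
    (hu16 : u ≤ 1 / 16) (heu : (e + 2) * u ≤ 1) (hr0 : 0 ≤ r) (hr1 : r ≤ u ^ 8) (hr0' : 0 ≤ r')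
    (hr1' : r' ≤ u ^ 8) (hw : 1 ≤ w)
    (h : |n * (e * u ^ 4 + r') - w * (n * (u ^ 4 + r))| ≤ 3 / 4 * (n * (u ^ 4 + r))) : e = w := by
  have h2' := abs_le.1 h
  have hwR : (1 : ℝ) ≤ w := by exact_mod_cast hw
  have h7 : (w - 3 / 4) * (u ^ 4 + r) ≤ e * u ^ 4 + r' := by
    refine le_of_mul_le_mul_left ?_ hnpos
    have := h2'.1
    nlinarith
  have h8 : e * u ^ 4 + r' ≤ (w + 3 / 4) * (u ^ 4 + r) := by
    refine le_of_mul_le_mul_left ?_ hnpos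
    have := h2'.2
    nlinarith
  have hu4pos : 0 < u ^ 4 := by positivity
  have hu8 : u ^ 8 ≤ u ^ 4 * (1 / 16) ^ 4 := by
    have : u ^ 4 ≤ (1 / 16) ^ 4 := by gcongr
    nlinarith
  have hlt1 : (w : ℝ) < e + 1 := by
    by_contra hcon
    have : (w - 3 / 4) * u ^ 4 ≤ (w - 3 / 4) * (u ^ 4 + r) := by
      apply mul_le_mul_of_nonneg_left <;> linarith
    nlinarith
  have hlt2 : (e : ℝ) < w + 1 := by
    by_contra hcon
    have h9 : (w + 3 / 4) * (u ^ 4 + r) ≤ (e - 1 / 4) * (u ^ 4 + u ^ 8) := by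
      apply mul_le_mul <;> linarith [pow_pos hupos 8]
    have h10 : e * u ^ 8 ≤ u ^ 4 * (1 / 16) ^ 3 := by
      have h11 : u ^ 3 ≤ (1 / 16) ^ 3 := by gcongr
      calc e * u ^ 8 = (e * u) * (u ^ 3 * u ^ 4) := by ring
        _ ≤ 1 * ((1 / 16) ^ 3 * u ^ 4) := by
            gcongr
            nlinarith
        _ = _ := by ring
    nlinarith [pow_pos hupos 8]
  have h12 : w < e + 1 := by exact_mod_cast hlt1
  have h13 : e < w + 1 := by exact_mod_cast hlt2
  omega

/-- A negative g makes g u + T negative because T < u. A positive g gives g u + T ≥ u ≥ 1/(16n²),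
which exceeds the permitted 1/(32n²). -/
theorem int_eq_zero_of_mul_add_small {n u T : ℝ} {g : ℤ} (hupos : 0 < u) (hu16 : u ≤ 1 / 16)
    (hn : 1 ≤ u * (16 * n ^ 2)) (hT0 : 0 ≤ T) (hT : T ≤ u ^ 2 / 2) (h0 : 0 < g * u + T)
    (h1 : (g * u + T) * (32 * n ^ 2) < 1) : g = 0 := by
  rcases lt_trichotomy g 0 with hg | hg | hg
  · exfalso
    have : (g : ℝ) ≤ -1 := by exact_mod_cast (by omega : g ≤ -1)
    nlinarith
  · exact hg
  · exfalso
    have : (1 : ℝ) ≤ g := by exact_mod_cast (by omega : 1 ≤ g)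
    have hu1 : u ≤ g * u + T := by nlinarith
    have : u * (32 * n ^ 2) < 1 := lt_of_le_of_lt (by gcongr) h1
    linarith

/-- Good rational approximations of `∑ 1 / lacDen j` determine a coefficient of
`∑ d j / lacDen j`. -/
theorem exists_coeff_eq {d : ℕ → ℕ} (hd : ∀ j, d j ≤ j + 1) {n w : ℕ} (hn : 1 ≤ n) (hw : 1 ≤ w)
    {p p' : ℤ} (h0 : 0 < lacSum (fun _ => 1) * n - p)
    (h1 : (lacSum (fun _ => 1) * n - p) * (32 * n ^ 2) < 1)
    (h2 : |(lacSum d * n - p') - w * (lacSum (fun _ => 1) * n - p)|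
      ≤ 3 / 4 * (lacSum (fun _ => 1) * n - p))
    (h3 : w * (lacSum (fun _ => 1) * n - p) ≤ 1 / 16) : ∃ i, d i = w := by
  have hone : ∀ j : ℕ, (fun _ => 1 : ℕ → ℕ) j ≤ j + 1 := fun j => by simp
  -- The scale Q = `lacDen i` satisfies Q ≤ 16n² < Q⁴. The first inequality makes 1/Q larger than
  -- the allowed error; the second gives 4n < Q², so that n times the tail stays far below 1/Q.
  obtain ⟨i, hi, hi'⟩ := exists_lacDen_le_lt (N := 16 * n ^ 2) (by nlinarith)
  refine ⟨i + 1, ?_⟩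
  obtain ⟨r, hr0, hr1, hr⟩ := lacTail_bounds hone i
  obtain ⟨r', hr0', hr1', hr'⟩ := lacTail_bounds hd i
  have hβ := lacSum_eq hone i
  have hα := lacSum_eq hd i
  have hcop := coprime_lacNum_one i
  rw [hr] at hβ
  rw [hr'] at hα
  rw [hβ] at h0 h1 h2 h3
  rw [hα] at h2
  rw [lacDen_succ] at hi'
  have hQ16 := sixteen_le_lacDen i
  have hQi := add_four_le_lacDen i
  have hdi := hd (i + 1)
  clear hβ hα hr hr'
  generalize lacDen i = Q at *
  generalize lacNum (fun _ => 1) i = A at *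
  generalize lacNum d i = B at *
  generalize d (i + 1) = e at *
  have h4n : 4 * n < Q ^ 2 := by
    by_contra hcon
    have : (Q ^ 2) ^ 2 ≤ (4 * n) ^ 2 := Nat.pow_le_pow_left (not_lt.1 hcon) 2
    nlinarith
  have hQR : (16 : ℝ) ≤ Q := by exact_mod_cast hQ16
  have hQpos : (0 : ℝ) < Q := by linarith
  have hnR : (1 : ℝ) ≤ n := by exact_mod_cast hn
  have hwR : (1 : ℝ) ≤ w := by exact_mod_cast hw
  have h4nR : 4 * (n : ℝ) ≤ (Q : ℝ) ^ 2 := by exact_mod_cast h4n.le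
  have hiR : (Q : ℝ) ≤ 16 * n ^ 2 := by exact_mod_cast hi
  have heQ : (e : ℝ) + 2 ≤ Q := by
    have : e + 2 ≤ Q := by omega
    exact_mod_cast this
  obtain ⟨u, hu⟩ : ∃ u : ℝ, u = 1 / Q := ⟨_, rfl⟩
  have hupos : 0 < u := by rw [hu]; positivity
  have hQu : (Q : ℝ) * u = 1 := by rw [hu]; field_simp
  have hu16 : u ≤ 1 / 16 := hu ▸ one_div_le_one_div_of_le (by norm_num) hQR
  have hinv : ∀ (z : ℝ) (m : ℕ), z / (Q : ℝ) ^ m = z * u ^ m := fun z m => by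
    rw [hu, one_div_pow]; ring
  have hinv1 : ∀ z : ℝ, z / (Q : ℝ) = z * u := fun z => by rw [hu]; ring
  rw [hinv] at hr1 hr1'
  simp only [hinv, hinv1, one_mul, Nat.cast_one] at h0 h1 h2 h3 hr1 hr1'
  -- `n * u ^ 2 ≤ 1 / 4`
  have hnu : n * u ^ 2 ≤ 1 / 4 := by
    have : (Q : ℝ) ^ 2 * u ^ 2 = 1 := by rw [← mul_pow, hQu, one_pow]
    nlinarith [sq_nonneg u]
  have hu4 : u ^ 8 ≤ u ^ 4 := pow_le_pow_of_le_one hupos.le (by linarith) (by norm_num)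
  have hnτ : n * (u ^ 4 + r) ≤ u ^ 2 / 2 := by
    have : n * (u ^ 4 + r) ≤ n * (2 * u ^ 4) := by gcongr; linarith
    nlinarith [sq_nonneg u, mul_le_mul_of_nonneg_left hnu (sq_nonneg u)]
  have hnτ0 : 0 ≤ n * (u ^ 4 + r) := by positivity
  -- the approximation has the denominator `Q`
  have hg : (A : ℤ) * n - p * Q = 0 := by
    have hb : (A * u + (u ^ 4 + r)) * n - p = (((A : ℤ) * n - p * Q : ℤ) : ℝ) * u
        + n * (u ^ 4 + r) := by
      push_cast
      linear_combination (p : ℝ) * hQu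
    rw [hb] at h0 h1
    generalize (A : ℤ) * n - p * Q = g at *
    refine int_eq_zero_of_mul_add_small hupos hu16 ?_ hnτ0 hnτ h0 h1
    have := mul_le_mul_of_nonneg_left hiR hupos.le
    linarith
  have hdvd : Q ∣ n := by
    have : (Q : ℤ) ∣ (A : ℤ) * n := ⟨p, by linarith⟩
    have : Q ∣ A * n := by exact_mod_cast this
    exact hcop.symm.dvd_of_dvd_mul_left this
  obtain ⟨m, rfl⟩ := hdvd
  have hp : p = A * m := by
    have hQ0 : (Q : ℤ) ≠ 0 := by positivity
    have h : (p - A * m) * (Q : ℤ) = 0 := by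
      push_cast at hg
      linear_combination -hg
    rcases mul_eq_zero.1 h with h | h
    · linarith
    · exact absurd h hQ0
  have hb : (A * u + (u ^ 4 + r)) * ((Q * m : ℕ) : ℝ) - p = ((Q * m : ℕ) : ℝ) * (u ^ 4 + r) := by
    rw [hp]
    push_cast
    linear_combination (A : ℝ) * m * hQu
  have ha : (B * u + (e * u ^ 4 + r')) * ((Q * m : ℕ) : ℝ) - p'
      = (((B : ℤ) * m - p' : ℤ) : ℝ) + ((Q * m : ℕ) : ℝ) * (e * u ^ 4 + r') := by
    push_cast
    linear_combination (B : ℝ) * m * hQu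
  rw [hb] at h0 h1 h2 h3
  rw [ha] at h2
  generalize (Q * m : ℕ) = n at *
  have heu : (e + 2) * u ≤ 1 := by nlinarith
  have hnτ' : n * (e * u ^ 4 + r') ≤ 1 / 4 := by
    calc n * (e * u ^ 4 + r') ≤ n * ((e + 2) * u ^ 4) :=
          mul_le_mul_of_nonneg_left (by linarith [pow_pos hupos 4]) (by linarith)
      _ = n * u ^ 2 * ((e + 2) * u * u) := by ring
      _ ≤ 1 / 4 * (1 * 1) := by
          gcongr
          linarith
      _ = 1 / 4 := by norm_num
  have hnτ0' : 0 ≤ n * (e * u ^ 4 + r') := by positivity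
  have h2' := abs_le.1 h2
  -- This integer has absolute value below 1: by `h2` and `h3` the total α n - p' is at most 1/16 +
  -- 3/64 in absolute value, and its tail part is at most 1/4.
  have hh : (B : ℤ) * m - p' = 0 := by
    generalize (B : ℤ) * m - p' = g at *
    have hle : n * (u ^ 4 + r) ≤ w * (n * (u ^ 4 + r)) := le_mul_of_one_le_left h0.le hwR
    have hlt : (g : ℝ) < 1 := by linarith
    have hgt : (-1 : ℝ) < g := by linarith
    have hlt' : g < 1 := by exact_mod_cast hlt
    have hgt' : -1 < g := by exact_mod_cast hgt
    omega
  rw [hh, Int.cast_zero, zero_add] at h2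
  exact natCast_eq_of_tail_ratio (by linarith) hupos hu16 heu hr0 hr1 hr0' hr1' hw h2

end SphereTC

namespace SphereTC

/-! ### The geometric reading of a coefficient -/

/-- The conditions under which the point with time coordinate `t`, angles `t`, `β t`, `α t` and
parameter `w` is accepted. -/
def Accepts (α β w t : ℝ) : Prop :=
  0 < t ∧ 0 < Real.cos (β * t) ∧ 0 < Real.cos (α * t) ∧ 0 < Real.sin (β * t) ∧
  1 - Real.cos t < Real.sin (β * t) ^ 4 / 16 ∧ Real.sin (β * t) * t ^ 2 < 1 ∧
  w ^ 2 * Real.sin (β * t) < 1 / 1000 ∧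
  (Real.sin (α * t) - w * Real.sin (β * t)) ^ 2 < Real.sin (β * t) ^ 2 / 4

theorem exists_int_abs_sub_le_pi (x : ℝ) : ∃ p : ℤ, |x - p * (2 * Real.pi)| ≤ Real.pi := by
  have hpi := Real.pi_pos
  refine ⟨round (x / (2 * Real.pi)), ?_⟩
  have h := abs_sub_round (x / (2 * Real.pi))
  have : x - round (x / (2 * Real.pi)) * (2 * Real.pi)
      = (x / (2 * Real.pi) - round (x / (2 * Real.pi))) * (2 * Real.pi) := by
    field_simp
  rw [this, abs_mul, abs_of_pos (by positivity : 0 < 2 * Real.pi)]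
  nlinarith

theorem abs_lt_pi_div_two_of_cos_pos {a : ℝ} (h : |a| ≤ Real.pi) (hc : 0 < Real.cos a) :
    |a| < Real.pi / 2 := by
  by_contra hcon
  rw [← Real.cos_abs] at hc
  have := Real.cos_nonpos_of_pi_div_two_le_of_le (not_lt.1 hcon) (by linarith [Real.pi_pos])
  linarith

theorem abs_le_two_mul_abs_sin {a : ℝ} (h : |a| ≤ Real.pi / 2) : |a| ≤ 2 * |Real.sin a| := by
  have h1 := Real.mul_abs_le_abs_sin h
  have h2 : 1 / 2 ≤ 2 / Real.pi := by
    rw [div_le_div_iff₀ (by norm_num) Real.pi_pos]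
    linarith [Real.pi_le_four]
  nlinarith [abs_nonneg a]

theorem abs_sub_sin_le (a : ℝ) : |a - Real.sin a| ≤ |a| ^ 3 / 6 := by
  have key : ∀ b : ℝ, 0 ≤ b → |b - Real.sin b| ≤ b ^ 3 / 6 := fun b hb => by
    rcases hb.eq_or_lt with rfl | hb
    · simp
    · rw [abs_of_nonneg (by linarith [Real.sin_le hb.le])]
      linarith [Real.sin_gt_sub_cube hb]
  rcases le_total 0 a with h | h
  · simpa [abs_of_nonneg h] using key a h
  · have := key (-a) (by linarith)
    rw [Real.sin_neg] at this
    rw [abs_of_nonpos h, ← abs_neg]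
    convert this using 2
    ring

/-- Put s = sin(βt). The bound on 1 - cos t places t within s² of some 2πm. Positive cosines put
both angles near 0 rather than π, so they are comparable with their sines. The bound s t² < 1 gives
the quality 1/(32m²) of the approximation, and w² s < 1/1000 keeps the cubic error of the α-angle,
about (ws)³ = (ws)(w²s)s, small against s. All errors together relax the factor 1/2 in the last
condition to 3/4. -/
theorem Accepts.exists_coeff_eq {d : ℕ → ℕ} (hd : ∀ j, d j ≤ j + 1) {w : ℕ} (hw : 1 ≤ w) {t : ℝ}
    (h : Accepts (lacSum d) (lacSum fun _ => 1) w t) : ∃ i, d i = w := by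
  obtain ⟨ht, hcβ, hcα, hs, hδ, hst, hws, hα⟩ := h
  have hβ0 := lacSum_nonneg fun _ => 1
  have hβ1 : lacSum (fun _ => 1) ≤ 1 := lacSum_le_one fun j => by simp
  have hα0 := lacSum_nonneg d
  have hα1 := lacSum_le_one hd
  have hcoeff := fun (n : ℕ) (hn : 1 ≤ n) (p p' : ℤ) =>
    SphereTC.exists_coeff_eq hd (n := n) hn hw (p := p) (p' := p')
  generalize lacSum d = α at *
  generalize lacSum (fun _ => 1) = β at *
  have hpi3 := Real.pi_gt_three
  have hpi4 := Real.pi_le_four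
  have hwR : (1 : ℝ) ≤ w := by exact_mod_cast hw
  obtain ⟨n, hn⟩ := exists_int_abs_sub_le_pi t
  obtain ⟨p, hp⟩ := exists_int_abs_sub_le_pi (β * t)
  obtain ⟨p', hp'⟩ := exists_int_abs_sub_le_pi (α * t)
  have hcos := Real.cos_le_one_sub_mul_cos_sq hn
  have ha := abs_lt_pi_div_two_of_cos_pos hp (by rwa [Real.cos_sub_int_mul_two_pi])
  have ha' := abs_lt_pi_div_two_of_cos_pos hp' (by rwa [Real.cos_sub_int_mul_two_pi])
  have h1 := abs_le_two_mul_abs_sin ha.le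
  have h1' := abs_le_two_mul_abs_sin ha'.le
  have h2 := abs_sub_sin_le (β * t - p * (2 * Real.pi))
  have h2' := abs_sub_sin_le (α * t - p' * (2 * Real.pi))
  have hsle : Real.sin (β * t) ≤ β * t := Real.sin_le (by positivity)
  have hapos : 0 < β * t - p * (2 * Real.pi) := by
    by_contra hcon
    have := Real.sin_nonpos_of_nonpos_of_neg_pi_le (not_lt.1 hcon) (by
      have := (abs_le.1 hp).1; linarith)
    rw [Real.sin_sub_int_mul_two_pi] at this
    linarith
  rw [Real.cos_sub_int_mul_two_pi] at hcos
  rw [Real.sin_sub_int_mul_two_pi] at h1 h1' h2 h2'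
  obtain ⟨s, hsdef⟩ : ∃ s, s = Real.sin (β * t) := ⟨_, rfl⟩
  obtain ⟨z, hzdef⟩ : ∃ z, z = Real.sin (α * t) := ⟨_, rfl⟩
  obtain ⟨δ, hδdef⟩ : ∃ δ, δ = t - n * (2 * Real.pi) := ⟨_, rfl⟩
  obtain ⟨a, hadef⟩ : ∃ a, a = β * t - p * (2 * Real.pi) := ⟨_, rfl⟩
  obtain ⟨a', hadef'⟩ : ∃ a', a' = α * t - p' * (2 * Real.pi) := ⟨_, rfl⟩
  rw [← hsdef] at hs hδ hst hws hα hsle h1 h2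
  rw [← hzdef] at hα h1' h2'
  rw [← hδdef] at hn hcos
  rw [← hadef] at h1 h2 ha hapos
  rw [← hadef'] at h1' h2' ha'
  have hs1 : s < 1 / 1000 := (le_mul_of_one_le_left hs.le (one_le_pow₀ hwR)).trans_lt hws
  have hws1 : w * s < 1 / 1000 :=
    (mul_le_mul_of_nonneg_right (le_self_pow₀ hwR two_ne_zero) hs.le).trans_lt hws
  have hsw : s ≤ w * s := le_mul_of_one_le_left hs.le hwR
  -- time is very close to a multiple of `2π`
  have hδs : |δ| ≤ s ^ 2 := by
    have h3 : 1 / 8 ≤ 2 / Real.pi ^ 2 := by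
      rw [div_le_div_iff₀ (by norm_num) (by positivity)]
      have := pow_le_pow_left₀ Real.pi_pos.le hpi4 2
      linarith
    have h4 : 1 / 8 * δ ^ 2 ≤ 2 / Real.pi ^ 2 * δ ^ 2 := by gcongr
    exact abs_le_of_sq_le_sq (by linarith [pow_pos hs 4, (by ring : (s ^ 2) ^ 2 = s ^ 4)]) (by positivity)
  have hδ' := abs_le.1 hδs
  have hs2 : s ^ 2 ≤ s / 1000 := by
    rw [sq, div_eq_mul_one_div]; gcongr
  -- Otherwise t ≤ δ ≤ s² ≤ s/1000, whereas s ≤ βt ≤ t.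
  have hn1 : 1 ≤ n := by
    by_contra hcon
    have hn0 : (n : ℝ) ≤ 0 := by exact_mod_cast (by omega : n ≤ 0)
    have h5 : (n : ℝ) * (2 * Real.pi) ≤ 0 := mul_nonpos_of_nonpos_of_nonneg hn0 (by positivity)
    have h6 : β * t ≤ t := mul_le_of_le_one_left ht.le hβ1
    linarith
  obtain ⟨m, rfl⟩ : ∃ m : ℕ, n = m := ⟨n.toNat, by omega⟩
  have hm1 : 1 ≤ m := by exact_mod_cast hn1
  rw [Int.cast_natCast] at hδdef
  rw [abs_of_pos hapos, abs_of_pos hs] at h1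
  rw [abs_of_pos hapos] at h2
  have h2s := abs_le.1 h2
  have ha3 : a ^ 3 ≤ 6 * (s / 1000) := by
    calc a ^ 3 ≤ (2 * s) ^ 3 := by gcongr
      _ = 8 * (s * s ^ 2) := by ring
      _ ≤ 8 * (1 / 1000 * (s / 1000)) := by gcongr
      _ ≤ 6 * (s / 1000) := by linarith
  -- the angle `α t`
  have hz : |z - w * s| ≤ s / 2 := abs_le_of_sq_le_sq (by rw [div_pow]; linarith) (by positivity)
  have hz' := abs_le.1 hz
  have hzw : |z| ≤ 2 * (w * s) := abs_le.2 ⟨by linarith, by linarith⟩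
  have ha3' : |a'| ^ 3 ≤ 6 * (s / 100) := by
    have h5 : |a'| ^ 3 ≤ (4 * (w * s)) ^ 3 := by
      gcongr
      linarith
    have h6 : (4 * (w * s)) ^ 3 = 64 * (w * s) * (w ^ 2 * s) * s := by ring
    have h7 : 64 * (w * s) * (w ^ 2 * s) * s ≤ 64 * (1 / 1000) * (1 / 1000) * s := by gcongr
    linarith
  have h2s' := abs_le.1 (h2'.trans (by linarith : |a'| ^ 3 / 6 ≤ s / 100))
  have hwa : w * (a - s) ≤ s / 100 := by
    have h5 : a - s ≤ (2 * s) ^ 3 / 6 := h2s.2.trans (by gcongr)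
    calc w * (a - s) ≤ w * ((2 * s) ^ 3 / 6) := by gcongr
      _ = 4 / 3 * (w * s) * s ^ 2 := by ring
      _ ≤ 4 / 3 * (1 / 1000) * (s / 1000) := by gcongr
      _ ≤ s / 100 := by linarith
  have hwa0 : s ≤ a := by rw [hsdef, ← Real.sin_sub_int_mul_two_pi _ p, ← hadef]
                          exact Real.sin_le hapos.le
  have hwδ : |w * (β * δ)| ≤ s / 100 := by
    rw [abs_mul, abs_mul, abs_of_nonneg hβ0, abs_of_nonneg (by positivity : (0 : ℝ) ≤ w)]
    calc w * (β * |δ|) ≤ w * (1 * s ^ 2) := by gcongr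
      _ = w * s * s := by ring
      _ ≤ 1 / 1000 * s := by gcongr
      _ ≤ s / 100 := by linarith
  have hβδ : |β * δ| ≤ s / 100 := by
    rw [abs_mul, abs_of_nonneg hβ0]
    linarith [mul_le_of_le_one_left (abs_nonneg δ) hβ1]
  have hαδ : |α * δ| ≤ s / 100 := by
    rw [abs_mul, abs_of_nonneg hα0]
    linarith [mul_le_of_le_one_left (abs_nonneg δ) hα1]
  have hb : 2 * Real.pi * (β * m - p) = a - β * δ := by rw [hadef, hδdef]; ring
  have hb' : 2 * Real.pi * (α * m - p') = a' - α * δ := by rw [hadef', hδdef]; ring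
  have hwδ' := abs_le.1 hwδ
  have hβδ' := abs_le.1 hβδ
  have hαδ' := abs_le.1 hαδ
  have hpos2 : 0 < 2 * Real.pi := by positivity
  specialize hcoeff m hm1 p p'
  generalize β * m - p = b at *
  generalize α * m - p' = b' at *
  have hb0 : 0 < b := pos_of_mul_pos_right (by linarith : 0 < 2 * Real.pi * b) hpos2.le
  have hbs : b ≤ s / 5 := by
    have : 6 * b ≤ 2 * Real.pi * b := by gcongr; linarith
    linarith
  have hmt : (m : ℝ) ≤ t / 5 := by
    have hm1' : (1 : ℝ) ≤ m := by exact_mod_cast hm1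
    have : m * 6 ≤ m * (2 * Real.pi) := by gcongr; linarith
    linarith
  have hsb : s * (99 / 100) ≤ 2 * Real.pi * b := by linarith
  refine hcoeff hb0 ?_ ?_ ?_
  · calc b * (32 * (m : ℝ) ^ 2) ≤ s / 5 * (32 * (t / 5) ^ 2) := by gcongr
      _ = 32 / 125 * (s * t ^ 2) := by ring
      _ < 1 := by linarith
  · have h8 : |2 * Real.pi * (b' - w * b)| ≤ 2 * Real.pi * (3 / 4 * b) := by
      have : 2 * Real.pi * (b' - w * b) = (a' - z) + (z - w * s) - w * (a - s) - α * δ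
          + w * (β * δ) := by
        linear_combination hb' - w * hb
      have hw0 : 0 ≤ w * (a - s) := mul_nonneg (by positivity) (by linarith)
      rw [this, abs_le]
      constructor <;> linarith
    rw [abs_mul, abs_of_pos hpos2] at h8
    exact le_of_mul_le_mul_left h8 hpos2
  · have : w * b ≤ w * (s / 5) := by gcongr
    linarith

/-- The angles y and x have the sizes u³ and w u³. Because w u ≤ 1, the terms x³ and w y³ are
negligible against u³, so replacing angles by sines does not spoil the proportionality. -/
theorem small_angle_bounds {u w x y : ℝ} (hupos : 0 < u) (husmall : u ≤ 1 / 65536) (hwR : 1 ≤ w)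
    (hwu : w * u ≤ 1) (hylow : 6 * u ^ 3 ≤ y) (hyup : y ≤ 9 * u ^ 3) (hxlow : 6 * (w * u ^ 3) ≤ x)
    (hxup : x ≤ 9 * (w * u ^ 3)) (hxy : |x - w * y| ≤ u ^ 3 / 100) :
    0 < Real.cos y ∧ 0 < Real.cos x ∧ 0 < Real.sin y ∧ Real.sin y ≤ 9 * u ^ 3 ∧
      w ^ 2 * Real.sin y < 1 / 1000 ∧ (Real.sin x - w * Real.sin y) ^ 2 < Real.sin y ^ 2 / 4 := by
  have hpi3 := Real.pi_gt_three
  have hu3 : 0 < u ^ 3 := by positivity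
  have hxy1 := (abs_le.1 hxy).2
  have hxy2 := (abs_le.1 hxy).1
  have hwu3 : u ^ 3 ≤ w * u ^ 3 := le_mul_of_one_le_left hu3.le hwR
  have hwu2 : w * u ^ 3 ≤ u ^ 2 := by
    calc w * u ^ 3 = (w * u) * u ^ 2 := by ring
      _ ≤ 1 * u ^ 2 := by gcongr
      _ = _ := one_mul _
  have hu2 : u ^ 2 ≤ u / 65536 := by
    rw [sq, div_eq_mul_one_div]; gcongr
  have hx1 : x < 1 := by linarith
  have hy1 : y < 1 := by linarith
  have hypos : 0 < y := by linarith
  have hxpos : 0 < x := by linarith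
  have hsiny : 0 < Real.sin y := Real.sin_pos_of_pos_of_lt_pi hypos (by linarith)
  have hcosy : 0 < Real.cos y := Real.cos_pos_of_mem_Ioo ⟨by linarith, by linarith⟩
  have hcosx : 0 < Real.cos x := Real.cos_pos_of_mem_Ioo ⟨by linarith, by linarith⟩
  have hsle := Real.sin_le hypos.le
  have hsyl : y / 2 ≤ Real.sin y := by
    have := abs_le_two_mul_abs_sin (a := y) (by rw [abs_of_pos hypos]; linarith)
    rw [abs_of_pos hypos, abs_of_pos hsiny] at this
    linarith
  refine ⟨hcosy, hcosx, hsiny, ?_, ?_, ?_⟩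
  · linarith
  · calc w ^ 2 * Real.sin y ≤ w ^ 2 * (9 * u ^ 3) := by
          gcongr
          linarith
      _ = 9 * (w * u) ^ 2 * u := by ring
      _ ≤ 9 * 1 ^ 2 * u := by gcongr
      _ < 1 / 1000 := by linarith
  · have h1 := abs_le.1 (abs_sub_sin_le x)
    have h2 := abs_le.1 (abs_sub_sin_le y)
    rw [abs_of_pos hxpos] at h1
    rw [abs_of_pos hypos] at h2
    have hx3 : x ^ 3 ≤ u ^ 3 / 10 := by
      calc x ^ 3 ≤ (9 * (w * u ^ 3)) ^ 3 := by gcongr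
        _ = 729 * (w * u) ^ 3 * u ^ 3 * u ^ 3 := by ring
        _ ≤ 729 * 1 ^ 3 * (1 / 65536) ^ 3 * u ^ 3 := by gcongr
        _ ≤ u ^ 3 / 10 := by linarith
    have hy3 : w * y ^ 3 ≤ u ^ 3 / 10 := by
      calc w * y ^ 3 ≤ w * (9 * u ^ 3) ^ 3 := by gcongr
        _ = 729 * (w * u) * u ^ 5 * u ^ 3 := by ring
        _ ≤ 729 * 1 * (1 / 65536) ^ 5 * u ^ 3 := by gcongr
        _ ≤ u ^ 3 / 10 := by linarith
    have h3 : w * (y - Real.sin y) ≤ w * (y ^ 3 / 6) := by gcongr; linarith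
    have h4 : w * (-(y ^ 3 / 6)) ≤ w * (y - Real.sin y) := by gcongr; linarith
    have h5 : |Real.sin x - w * Real.sin y| ≤ u ^ 3 := by
      rw [abs_le]
      constructor <;> linarith
    have h7 : (Real.sin x - w * Real.sin y) ^ 2 ≤ (u ^ 3) ^ 2 := sq_le_sq' (by
      have := (abs_le.1 h5).1; linarith) (abs_le.1 h5).2
    have h8 : (2 * u ^ 3) ^ 2 < Real.sin y ^ 2 := by
      apply pow_lt_pow_left₀ _ (by positivity) (by norm_num)
      linarith
    linarith

/-- The partial sums have denominator Q = `lacDen i`, so 2πQ times them is a whole number of turns,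
and the angles become 2πQ times the tails. The requirement 1 ≤ i gives Q ≥ 65536, enough room for
all numerical constants. -/
theorem accepts_of_lacDen {d : ℕ → ℕ} (hd : ∀ j, d j ≤ j + 1) {i : ℕ} (hi : 1 ≤ i)
    (hw : 1 ≤ d (i + 1)) :
    Accepts (lacSum d) (lacSum fun _ => 1) (d (i + 1)) (2 * Real.pi * lacDen i) := by
  have hone : ∀ j : ℕ, (fun _ => 1 : ℕ → ℕ) j ≤ j + 1 := fun j => by simp
  obtain ⟨r, hr0, hr1, hr⟩ := lacTail_bounds hone i
  obtain ⟨r', hr0', hr1', hr'⟩ := lacTail_bounds hd i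
  have hβ := lacSum_eq hone i
  have hα := lacSum_eq hd i
  rw [hr] at hβ
  rw [hr'] at hα
  have hQ : 65536 ≤ lacDen i := by
    have := lacDen_strictMono.monotone hi
    rwa [lacDen_succ, lacDen_zero] at this
  have hwQ : d (i + 1) ≤ lacDen i := by
    have := add_four_le_lacDen i
    have := hd (i + 1)
    omega
  generalize lacSum d = α at *
  generalize lacSum (fun _ => 1) = β at *
  generalize lacDen i = Q at *
  generalize lacNum (fun _ => 1) i = A at *
  generalize lacNum d i = B at *
  generalize d (i + 1) = w at *
  have hQR : (65536 : ℝ) ≤ Q := by exact_mod_cast hQ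
  have hwR : (1 : ℝ) ≤ w := by exact_mod_cast hw
  have hwQR : (w : ℝ) ≤ Q := by exact_mod_cast hwQ
  have hQpos : (0 : ℝ) < Q := by linarith
  have hpi3 := Real.pi_gt_three
  have hpi4 := Real.pi_le_four
  obtain ⟨u, hu⟩ : ∃ u : ℝ, u = 1 / Q := ⟨_, rfl⟩
  have hupos : 0 < u := by rw [hu]; positivity
  have hQu : (Q : ℝ) * u = 1 := by rw [hu]; field_simp
  have husmall : u ≤ 1 / 65536 := hu ▸ one_div_le_one_div_of_le (by norm_num) hQR
  have hwu : w * u ≤ 1 := (mul_le_mul_of_nonneg_right hwQR hupos.le).trans_eq hQu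
  have hinv : ∀ (z : ℝ) (m : ℕ), z / (Q : ℝ) ^ m = z * u ^ m := fun z m => by
    rw [hu, one_div_pow]; ring
  have hinv1 : ∀ z : ℝ, z / (Q : ℝ) = z * u := fun z => by rw [hu]; ring
  simp only [hinv, hinv1, one_mul, Nat.cast_one] at hr1 hr1' hβ hα
  obtain ⟨y, hy⟩ : ∃ y, y = 2 * Real.pi * (u ^ 3 + Q * r) := ⟨_, rfl⟩
  obtain ⟨x, hx⟩ : ∃ x, x = 2 * Real.pi * (w * u ^ 3 + Q * r') := ⟨_, rfl⟩
  have hβt : β * (2 * Real.pi * Q) = y + A * (2 * Real.pi) := by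
    rw [hβ, hy]
    linear_combination (2 * Real.pi) * (A + u ^ 3) * hQu
  have hαt : α * (2 * Real.pi * Q) = x + B * (2 * Real.pi) := by
    rw [hα, hx]
    linear_combination (2 * Real.pi) * (B + w * u ^ 3) * hQu
  have hQr : Q * r ≤ u ^ 7 := by
    calc Q * r ≤ Q * u ^ 8 := by gcongr
      _ = u ^ 7 := by linear_combination u ^ 7 * hQu
  have hQr' : Q * r' ≤ u ^ 7 := by
    calc Q * r' ≤ Q * u ^ 8 := by gcongr
      _ = u ^ 7 := by linear_combination u ^ 7 * hQu
  have hQr0 : 0 ≤ Q * r := by positivity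
  have hQr0' : 0 ≤ Q * r' := by positivity
  generalize Q * r = ρ at *
  generalize Q * r' = ρ' at *
  have hu3 : 0 < u ^ 3 := by positivity
  have hu7 : u ^ 7 ≤ u ^ 3 / 1000 := by
    have : u ^ 4 ≤ 1 / 1000 := by
      calc u ^ 4 ≤ (1 / 65536) ^ 4 := by gcongr
        _ ≤ 1 / 1000 := by norm_num
    calc u ^ 7 = u ^ 3 * u ^ 4 := by ring
      _ ≤ u ^ 3 * (1 / 1000) := by gcongr
      _ = _ := by ring
  have hpi6 : 6 ≤ 2 * Real.pi := by linarith
  have hpi8 : 2 * Real.pi ≤ 8 := by linarith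
  have hylow : 6 * u ^ 3 ≤ y := by
    rw [hy]
    gcongr
    linarith
  have hyup : y ≤ 9 * u ^ 3 := by
    calc y ≤ 8 * (u ^ 3 + u ^ 3 / 1000) := by rw [hy]; gcongr; linarith
      _ ≤ 9 * u ^ 3 := by linarith
  have hwR3 : u ^ 3 ≤ w * u ^ 3 := le_mul_of_one_le_left hu3.le hwR
  have hxlow : 6 * (w * u ^ 3) ≤ x := by
    rw [hx]
    gcongr
    linarith
  have hxup : x ≤ 9 * (w * u ^ 3) := by
    calc x ≤ 8 * (w * u ^ 3 + u ^ 3 / 1000) := by rw [hx]; gcongr; linarith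
      _ ≤ 9 * (w * u ^ 3) := by linarith
  have hwρ : w * ρ ≤ u ^ 3 / 1000 := by
    calc w * ρ ≤ w * u ^ 7 := by gcongr
      _ = (w * u) * u ^ 3 * u ^ 3 := by ring
      _ ≤ 1 * (1 / 65536) ^ 3 * u ^ 3 := by gcongr
      _ ≤ u ^ 3 / 1000 := by linarith
  have hxy : x - w * y = 2 * Real.pi * (ρ' - w * ρ) := by rw [hx, hy]; ring
  have hwρ0 : 0 ≤ w * ρ := by positivity
  have hxy1 : |x - w * y| ≤ u ^ 3 / 100 := by
    rw [hxy, abs_mul, abs_of_pos (by positivity)]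
    calc 2 * Real.pi * |ρ' - w * ρ| ≤ 8 * (u ^ 3 / 1000) := by
          gcongr
          exact abs_le.2 ⟨by linarith, by linarith⟩
      _ ≤ u ^ 3 / 100 := by linarith
  obtain ⟨h1, h2, h3, h4, h5, h6⟩ := small_angle_bounds hupos husmall hwR hwu hylow hyup hxlow hxup hxy1
  have hcos : Real.cos (2 * Real.pi * Q) = 1 := by
    rw [mul_comm]; exact Real.cos_nat_mul_two_pi Q
  unfold Accepts
  rw [hcos, hβt, hαt, Real.cos_add_nat_mul_two_pi, Real.cos_add_nat_mul_two_pi,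
    Real.sin_add_nat_mul_two_pi, Real.sin_add_nat_mul_two_pi]
  refine ⟨by positivity, h1, h2, h3, ?_, ?_, h5, h6⟩
  · rw [sub_self]
    positivity
  · calc Real.sin y * (2 * Real.pi * Q) ^ 2 ≤ (9 * u ^ 3) * (8 * Q) ^ 2 := by
          gcongr
      _ = 576 * u * (Q * u) ^ 2 := by ring
      _ = 576 * u := by rw [hQu]; ring
      _ < 1 := by linarith

end SphereTC

namespace SphereTC

/-! ### Orbits -/

/-- Over a compact interval inside I with 0 in its interior, both curves stay in a compact set,
where the field is Lipschitz, and ODE uniqueness applies. -/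
theorem eqOn_of_isIntegralCurveOn {E : Type*} [NormedAddCommGroup E] [NormedSpace ℝ E]
    {X : E → E} (hX : LocallyLipschitz X) {γ η : ℝ → E} {I : Set ℝ} (hI : IsOpen I)
    (hI' : I.OrdConnected) (h0 : 0 ∈ I) (hγ : IsIntegralCurveOn γ (fun _ => X) I)
    (hη : ∀ t, HasDerivAt η (X (η t)) t) (h : γ 0 = η 0) : Set.EqOn γ η I := by
  intro t ht
  have hmin : min 0 t ∈ I := by rcases min_choice 0 t with h | h <;> rw [h] <;> assumption
  have hmax : max 0 t ∈ I := by rcases max_choice 0 t with h | h <;> rw [h] <;> assumption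
  obtain ⟨ε, hε, hball⟩ := Metric.isOpen_iff.1 hI _ hmin
  obtain ⟨ε', hε', hball'⟩ := Metric.isOpen_iff.1 hI _ hmax
  have ha : min 0 t - ε / 2 ∈ I := hball (by
    rw [Metric.mem_ball, Real.dist_eq, abs_lt]; constructor <;> linarith)
  have hb : max 0 t + ε' / 2 ∈ I := hball' (by
    rw [Metric.mem_ball, Real.dist_eq, abs_lt]; constructor <;> linarith)
  set a := min 0 t - ε / 2 with ha_def
  set b := max 0 t + ε' / 2 with hb_def
  have hsub : Set.Icc a b ⊆ I := hI'.out ha hb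
  have h0ab : (0 : ℝ) ∈ Set.Ioo a b :=
    ⟨by have := min_le_left 0 t; linarith, by have := le_max_left 0 t; linarith⟩
  have htab : t ∈ Set.Icc a b :=
    ⟨by have := min_le_right 0 t; linarith, by have := le_max_right 0 t; linarith⟩
  have hγd : ∀ s ∈ I, HasDerivAt γ (X (γ s)) s := fun s hs => (hγ s hs).hasDerivAt (hI.mem_nhds hs)
  have hγc : ContinuousOn γ (Set.Icc a b) := fun s hs =>
    (hγd s (hsub hs)).continuousAt.continuousWithinAt
  have hηc : ContinuousOn η (Set.Icc a b) := fun s _ => (hη s).continuousAt.continuousWithinAt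
  have hK : IsCompact (γ '' Set.Icc a b ∪ η '' Set.Icc a b) :=
    (isCompact_Icc.image_of_continuousOn hγc).union (isCompact_Icc.image_of_continuousOn hηc)
  obtain ⟨K, hKL⟩ := (hX.locallyLipschitzOn (s := γ '' Set.Icc a b ∪ η '' Set.Icc a b)
    ).exists_lipschitzOnWith_of_compact hK
  exact ODE_solution_unique_of_mem_Icc (v := fun _ => X) (K := K)
    (s := fun _ => γ '' Set.Icc a b ∪ η '' Set.Icc a b) (fun _ _ => hKL) h0ab hγc
    (fun s hs => hγd s (hsub (Set.Ioo_subset_Icc_self hs)))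
    (fun s hs => Or.inl ⟨s, Set.Ioo_subset_Icc_self hs, rfl⟩) hηc (fun s _ => hη s)
    (fun s hs => Or.inr ⟨s, Set.Ioo_subset_Icc_self hs, rfl⟩) h htab

theorem orbit_eq_range {m : ℕ} {M : Set (EuclideanSpace ℝ (Fin m))}
    {X : EuclideanSpace ℝ (Fin m) → EuclideanSpace ℝ (Fin m)} (hX : LocallyLipschitz X)
    {η : ℝ → EuclideanSpace ℝ (Fin m)} (hη : ∀ t, HasDerivAt η (X (η t)) t) (hM : ∀ t, η t ∈ M) :
    orbit M X (η 0) = Set.range η := by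
  ext y
  constructor
  · rintro ⟨γ, I, hI, hI', h0, hγ0, -, hγ, t, ht, rfl⟩
    exact ⟨t, (eqOn_of_isIntegralCurveOn hX hI hI' h0 hγ hη hγ0 ht).symm⟩
  · rintro ⟨t, rfl⟩
    exact ⟨η, Set.univ, isOpen_univ, Set.ordConnected_univ, Set.mem_univ _, rfl,
      fun t _ => hM t, fun t _ => (hη t).hasDerivWithinAt, t, Set.mem_univ _, rfl⟩

/-- A change of time with prescribed positive speed. -/
theorem exists_time_change {g : ℝ → ℝ} (hg : Continuous g) {c : ℝ} (hc : 0 < c)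
    (hcg : ∀ t, c ≤ g t) :
    ∃ σ : ℝ → ℝ, σ 0 = 0 ∧ Function.Surjective σ ∧ ∀ s, HasDerivAt σ (g (σ s))⁻¹ s := by
  -- S is new time as a function of old time. The lower bound c makes it a bijection of ℝ; its
  -- inverse is the required change of time.
  set S : ℝ → ℝ := fun t => ∫ x in (0 : ℝ)..t, g x with hS
  have hS' : ∀ t, HasDerivAt S (g t) t := fun t =>
    intervalIntegral.integral_hasDerivAt_right (hg.intervalIntegrable _ _)
      hg.stronglyMeasurable.stronglyMeasurableAtFilter hg.continuousAt
  have hScont : Continuous S := continuous_iff_continuousAt.2 fun t => (hS' t).continuousAt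
  have hmono : StrictMono S := strictMono_of_hasDerivAt_pos hS' fun t => hc.trans_le (hcg t)
  have hd : ∀ t, HasDerivAt (fun t => S t - c * t) (g t - c) t := fun t =>
    (hS' t).sub (by simpa using (hasDerivAt_id t).const_mul c)
  have hdiff : Monotone fun t => S t - c * t := monotone_of_deriv_nonneg
    (fun t => (hd t).differentiableAt) fun t => by
      rw [(hd t).deriv]
      linarith [hcg t]
  have hS0 : S 0 = 0 := by simp [hS]
  have htop : Filter.Tendsto S Filter.atTop Filter.atTop :=
    Filter.tendsto_atTop_mono' _ (Filter.eventually_ge_atTop 0 |>.mono fun t ht => by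
      have := hdiff ht
      simp only [hS0] at this
      simp only [id]
      linarith) (Filter.tendsto_id.const_mul_atTop hc)
  have hbot : Filter.Tendsto S Filter.atBot Filter.atBot :=
    Filter.tendsto_atBot_mono' _ (Filter.eventually_le_atBot 0 |>.mono fun t ht => by
      have := hdiff ht
      simp only [hS0] at this
      simp only [id]
      linarith) (Filter.tendsto_id.const_mul_atBot hc)
  let e := hmono.orderIsoOfSurjective S (hScont.surjective htop hbot)
  have he : ∀ t, e t = S t := fun t => rfl
  refine ⟨e.symm, ?_, e.symm.surjective, fun s => ?_⟩
  · rw [OrderIso.symm_apply_eq, he, hS0]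
  · refine HasDerivAt.of_local_left_inverse (f := S) e.symm.continuous.continuousAt (hS' _)
      (hc.trans_le (hcg _)).ne' (Filter.Eventually.of_forall fun y => ?_)
    rw [← he, OrderIso.apply_symm_apply]

theorem hasDerivAt_toLp {m : ℕ} {f : ℝ → Fin m → ℝ} {f' : Fin m → ℝ} {t : ℝ}
    (h : ∀ i, HasDerivAt (fun s => f s i) (f' i) t) :
    HasDerivAt (fun s => (WithLp.toLp 2 (f s) : EuclideanSpace ℝ (Fin m))) (WithLp.toLp 2 f') t :=
  ((PiLp.continuousLinearEquiv 2 ℝ fun _ : Fin m => ℝ).symm.hasFDerivAt).comp_hasDerivAt t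
    (hasDerivAt_pi.2 h)

theorem PolyField.contDiff_toFun {m : ℕ} (P : PolyField m) : ContDiff ℝ 1 P.toFun := by
  refine (PiLp.continuousLinearEquiv 2 ℝ fun _ : Fin m => ℝ).symm.contDiff.comp
    (contDiff_pi.2 fun i => ?_)
  have h : AnalyticOnNhd ℝ (fun x : Fin m → ℝ => MvPolynomial.eval x (P i)) Set.univ :=
    AnalyticOnNhd.eval_mvPolynomial (P i)
  exact h.contDiff.comp (PiLp.continuousLinearEquiv 2 ℝ fun _ : Fin m => ℝ).contDiff

theorem PolyField.locallyLipschitz_toFun {m : ℕ} (P : PolyField m) : LocallyLipschitz P.toFun :=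
  P.contDiff_toFun.locallyLipschitz

/-! ### Inverse stereographic projection -/

section

variable {n : ℕ}

theorem invStereo_zero (x : EuclideanSpace ℝ (Fin n)) :
    invStereo n x 0 = (‖x‖ ^ 2 - 1) / (1 + ‖x‖ ^ 2) := rfl

theorem invStereo_succ (x : EuclideanSpace ℝ (Fin n)) (k : Fin n) :
    invStereo n x k.succ = 2 * x k / (1 + ‖x‖ ^ 2) := rfl

theorem one_sub_invStereo_zero (x : EuclideanSpace ℝ (Fin n)) :
    1 - invStereo n x 0 = 2 / (1 + ‖x‖ ^ 2) := by
  have : 1 + ‖x‖ ^ 2 ≠ 0 := by positivity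
  rw [invStereo_zero]
  field_simp
  ring

theorem invStereo_mem_unitSphere (x : EuclideanSpace ℝ (Fin n)) :
    invStereo n x ∈ unitSphere n := by
  have h : 1 + ‖x‖ ^ 2 ≠ 0 := by positivity
  rw [unitSphere, mem_sphere_zero_iff_norm, ← sq_eq_sq₀ (norm_nonneg _) zero_le_one,
    EuclideanSpace.real_norm_sq_eq, Fin.sum_univ_succ]
  simp only [invStereo_zero, invStereo_succ, div_pow, mul_pow]
  rw [← Finset.sum_div, ← Finset.mul_sum, ← EuclideanSpace.real_norm_sq_eq]
  field_simp
  ring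

theorem differentiable_invStereo : Differentiable ℝ (invStereo n) := by
  have hsq : Differentiable ℝ fun x : EuclideanSpace ℝ (Fin n) => ‖x‖ ^ 2 :=
    differentiable_id.norm_sq ℝ
  have hne : ∀ x : EuclideanSpace ℝ (Fin n), 1 + ‖x‖ ^ 2 ≠ 0 := fun x => by positivity
  have hinv : Differentiable ℝ fun x : EuclideanSpace ℝ (Fin n) => (1 + ‖x‖ ^ 2)⁻¹ :=
    (hsq.const_add 1).inv hne
  refine (PiLp.continuousLinearEquiv 2 ℝ fun _ : Fin (n + 1) => ℝ).symm.differentiable.comp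
    (differentiable_pi.2 fun i => ?_)
  refine Fin.cases ?_ (fun k => ?_) i
  · have : Differentiable ℝ fun x : EuclideanSpace ℝ (Fin n) => (‖x‖ ^ 2 - 1) / (1 + ‖x‖ ^ 2) :=
      (hsq.sub_const 1).mul hinv
    exact this
  · have hk : Differentiable ℝ fun x : EuclideanSpace ℝ (Fin n) => x k :=
      (EuclideanSpace.proj k : EuclideanSpace ℝ (Fin n) →L[ℝ] ℝ).differentiable
    have : Differentiable ℝ fun x : EuclideanSpace ℝ (Fin n) => 2 * x k / (1 + ‖x‖ ^ 2) :=
      (hk.const_mul 2).mul hinv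
    exact this

theorem fderiv_invStereo (x v : EuclideanSpace ℝ (Fin n)) :
    fderiv ℝ (invStereo n) x v = WithLp.toLp 2 (Fin.cons (4 * inner ℝ x v / (1 + ‖x‖ ^ 2) ^ 2)
      fun k => 2 * v k / (1 + ‖x‖ ^ 2) - 4 * x k * inner ℝ x v / (1 + ‖x‖ ^ 2) ^ 2) := by
  have h1 : HasDerivAt (fun t : ℝ => x + t • v) v 0 := by
    simpa using ((hasDerivAt_id (0 : ℝ)).smul_const v).const_add x
  have h2 : HasDerivAt (fun t : ℝ => invStereo n (x + t • v)) (fderiv ℝ (invStereo n) x v) 0 := by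
    have := (differentiable_invStereo (x + (0 : ℝ) • v)).hasFDerivAt.comp_hasDerivAt (0 : ℝ) h1
    rw [zero_smul, add_zero] at this
    exact this
  have hne : 1 + ‖x‖ ^ 2 ≠ 0 := by positivity
  have hsq : HasDerivAt (fun t : ℝ => ‖x + t • v‖ ^ 2) (2 * inner ℝ x v) 0 := by
    have := h1.norm_sq
    simpa using this
  refine h2.unique (hasDerivAt_toLp fun i => ?_)
  refine Fin.cases ?_ (fun k => ?_) i
  · have h := (hsq.sub_const 1).div (hsq.const_add 1) (by simpa using hne)
    rw [zero_smul, add_zero] at h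
    refine h.congr_deriv ?_
    rw [Fin.cons_zero]
    field_simp
    ring
  · have hk : HasDerivAt (fun t : ℝ => (x + t • v) k) (v k) 0 := by
      have := ((hasDerivAt_id (0 : ℝ)).mul_const (v k)).const_add (x k)
      simpa using this
    have h := (hk.const_mul 2).div (hsq.const_add 1) (by simpa using hne)
    rw [zero_smul, add_zero] at h
    refine h.congr_deriv ?_
    rw [Fin.cons_succ]
    field_simp
    ring

end

end SphereTC

namespace SphereTC

open MvPolynomial

/-! ### Homogenization with respect to `1 - y₀` -/

/-- Replace `x ^ m` by `y ^ m * (1 - y₀) ^ (d - |m|)`, where `y₁, …, yₙ` are the variables that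
correspond to `x₁, …, xₙ`. -/
noncomputable def homog {n : ℕ} {R : Type*} [CommRing R] (d : ℕ) (p : MvPolynomial (Fin n) R) :
    MvPolynomial (Fin (n + 1)) R :=
  ∑ m ∈ p.support, C (coeff m p) * ((∏ i, X i.succ ^ m i) * (1 - X 0) ^ (d - ∑ i, m i))

section

variable {n : ℕ} {R : Type*} [CommRing R]

theorem sum_le_totalDegree {p : MvPolynomial (Fin n) R} {m : Fin n →₀ ℕ} (hm : m ∈ p.support) :
    ∑ i, m i ≤ p.totalDegree := by
  have := le_totalDegree hm
  rwa [Finsupp.sum_fintype _ _ fun _ => rfl] at this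

/-- Every monomial acquires exactly the factor (1 - y₀)^d. The coefficient ring is general because
this serves both the real field and the rational polynomials of the open set. -/
theorem aeval_homog [Algebra R ℝ] {d : ℕ} {p : MvPolynomial (Fin n) R} (hp : p.totalDegree ≤ d)
    (y : Fin (n + 1) → ℝ) (x : Fin n → ℝ) (h : ∀ k, y k.succ = (1 - y 0) * x k) :
    aeval y (homog d p) = (1 - y 0) ^ d * aeval x p := by
  rw [homog, map_sum, aeval_def x, eval₂_eq', Finset.mul_sum]
  refine Finset.sum_congr rfl fun m hm => ?_
  have hle := (sum_le_totalDegree hm).trans hp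
  simp only [map_mul, map_prod, map_pow, map_sub, map_one, aeval_X, aeval_C, h, mul_pow,
    Finset.prod_mul_distrib, Finset.prod_pow_eq_pow_sum]
  rw [← Nat.add_sub_cancel' hle, pow_add, Nat.add_sub_cancel_left]
  ring

theorem totalDegree_one_sub_X_le (i : Fin (n + 1)) :
    (1 - X i : MvPolynomial (Fin (n + 1)) ℝ).totalDegree ≤ 1 :=
  (totalDegree_sub _ _).trans (by simp)

theorem totalDegree_homog_le {d : ℕ} {p : MvPolynomial (Fin n) ℝ} (hp : p.totalDegree ≤ d) :
    (homog d p).totalDegree ≤ d := by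
  refine totalDegree_finsetSum_le fun m hm => ?_
  have hle := (sum_le_totalDegree hm).trans hp
  have h1 : (∏ i : Fin n, (X i.succ : MvPolynomial (Fin (n + 1)) ℝ) ^ m i).totalDegree
      ≤ ∑ i, m i := by
    refine (totalDegree_finsetProd _ _).trans (Finset.sum_le_sum fun i _ => ?_)
    rw [totalDegree_X_pow]
  have h2 : ((1 - X 0 : MvPolynomial (Fin (n + 1)) ℝ) ^ (d - ∑ i, m i)).totalDegree
      ≤ d - ∑ i, m i := by
    refine (totalDegree_pow _ _).trans ?_
    simpa using Nat.mul_le_mul_left (d - ∑ i, m i) (totalDegree_one_sub_X_le (0 : Fin (n + 1)))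
  have h3 := totalDegree_mul (C (coeff m p))
    ((∏ i : Fin n, (X i.succ : MvPolynomial (Fin (n + 1)) ℝ) ^ m i) * (1 - X 0) ^ (d - ∑ i, m i))
  have h4 := totalDegree_mul (∏ i : Fin n, (X i.succ : MvPolynomial (Fin (n + 1)) ℝ) ^ m i)
    ((1 - X 0) ^ (d - ∑ i, m i))
  rw [totalDegree_C] at h3
  omega

theorem homog_X_pow (d : ℕ) (i : Fin n) :
    homog d (X i ^ d : MvPolynomial (Fin n) ℝ) = X i.succ ^ d := by
  rw [homog, X_pow_eq_monomial, support_monomial, if_neg one_ne_zero, Finset.sum_singleton,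
    coeff_monomial, if_pos rfl, C_1, one_mul]
  simp only [Finsupp.single_apply]
  rw [Finset.sum_ite_eq, if_pos (Finset.mem_univ _), Nat.sub_self, pow_zero, mul_one,
    Finset.prod_eq_single i]
  · rw [if_pos rfl]
  · intro j _ hj
    rw [if_neg (Ne.symm hj), pow_zero]
  · simp

end

/-! ### Polynomials with computable coefficients -/

/-- All coefficients are computable reals. -/
def HasComputableCoeffs {σ : Type*} (p : MvPolynomial σ ℝ) : Prop :=
  ∀ e, IsComputableReal (coeff e p)

namespace HasComputableCoeffs

variable {σ : Type*} {p q : MvPolynomial σ ℝ}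

theorem zero : HasComputableCoeffs (0 : MvPolynomial σ ℝ) := fun e => by
  rw [coeff_zero]
  exact .zero

theorem C {a : ℝ} (ha : IsComputableReal a) : HasComputableCoeffs (C a : MvPolynomial σ ℝ) :=
  fun e => by
    classical
    rw [coeff_C]
    split_ifs
    exacts [ha, .zero]

theorem add (hp : HasComputableCoeffs p) (hq : HasComputableCoeffs q) :
    HasComputableCoeffs (p + q) := fun e => by
  rw [coeff_add]
  exact (hp e).add (hq e)

theorem neg (hp : HasComputableCoeffs p) : HasComputableCoeffs (-p) := fun e => by
  rw [coeff_neg]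
  exact (hp e).neg

theorem sub (hp : HasComputableCoeffs p) (hq : HasComputableCoeffs q) :
    HasComputableCoeffs (p - q) := sub_eq_add_neg p q ▸ hp.add hq.neg

/-- The sphere field arises from P by sums and by products with X i and 1 - X i, so products of
computable reals never occur. -/
theorem mul_X (hp : HasComputableCoeffs p) (i : σ) : HasComputableCoeffs (p * X i) := fun e => by
  classical
  rw [coeff_mul_X']
  split_ifs
  exacts [hp _, .zero]

theorem mul_X_pow (hp : HasComputableCoeffs p) (i : σ) (k : ℕ) :
    HasComputableCoeffs (p * X i ^ k) := by
  induction k with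
  | zero => simpa using hp
  | succ k ih => rw [pow_succ, ← mul_assoc]; exact ih.mul_X i

theorem mul_one_sub_X (hp : HasComputableCoeffs p) (i : σ) :
    HasComputableCoeffs (p * (1 - X i)) := by
  rw [mul_sub, mul_one]
  exact hp.sub (hp.mul_X i)

theorem mul_one_sub_X_pow (hp : HasComputableCoeffs p) (i : σ) (k : ℕ) :
    HasComputableCoeffs (p * (1 - X i) ^ k) := by
  induction k with
  | zero => simpa using hp
  | succ k ih => rw [pow_succ, ← mul_assoc]; exact ih.mul_one_sub_X i

theorem mul_prod_X_pow {ι : Type*} (hp : HasComputableCoeffs p) (s : Finset ι) (f : ι → σ)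
    (k : ι → ℕ) : HasComputableCoeffs (p * ∏ i ∈ s, X (f i) ^ k i) := by
  classical
  induction s using Finset.induction_on with
  | empty => simpa using hp
  | insert a s ha ih =>
    rw [Finset.prod_insert ha, mul_comm (X (f a) ^ k a), ← mul_assoc]
    exact ih.mul_X_pow _ _

theorem sum {ι : Type*} {s : Finset ι} {f : ι → MvPolynomial σ ℝ}
    (h : ∀ i ∈ s, HasComputableCoeffs (f i)) : HasComputableCoeffs (∑ i ∈ s, f i) :=
  Finset.sum_induction f HasComputableCoeffs (fun _ _ => add) zero h

theorem homog {n : ℕ} {p : MvPolynomial (Fin n) ℝ} (hp : HasComputableCoeffs p) (d : ℕ) :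
    HasComputableCoeffs (homog d p) :=
  sum fun m _ => by
    rw [← mul_assoc]
    exact ((C (hp m)).mul_prod_X_pow _ _ _).mul_one_sub_X_pow _ _

end HasComputableCoeffs

/-! ### The push-forward to the sphere -/

section

variable {n : ℕ}

/-- The polynomial `∑ k, y_k Q_k`, where `Q_k` is the homogenization of `P_k`. -/
noncomputable def radialPart (d : ℕ) (P : PolyField n) : MvPolynomial (Fin (n + 1)) ℝ :=
  ∑ k, homog d (P k) * X k.succ

/-- The polynomial field on the sphere that extends the push-forward of `2 ^ d / (1 + r²) ^ d • P`
under the inverse stereographic projection. -/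
noncomputable def sphereField (d : ℕ) (P : PolyField n) : PolyField (n + 1) :=
  Fin.cons (radialPart d P * (1 - X 0))
    fun k => homog d (P k) * (1 - X 0) - radialPart d P * X k.succ

theorem sphereField_zero (d : ℕ) (P : PolyField n) :
    sphereField d P 0 = radialPart d P * (1 - X 0) := rfl

theorem sphereField_succ (d : ℕ) (P : PolyField n) (k : Fin n) :
    sphereField d P k.succ = homog d (P k) * (1 - X 0) - radialPart d P * X k.succ := rfl

theorem PolyField.Constructible.sphereField {P : PolyField n} (hP : P.Constructible) (d : ℕ) :
    (sphereField d P).Constructible := by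
  have hQ : ∀ k, HasComputableCoeffs (homog d (P k)) := fun k => HasComputableCoeffs.homog (hP k) d
  have hS : HasComputableCoeffs (radialPart d P) :=
    HasComputableCoeffs.sum fun k _ => (hQ k).mul_X _
  refine fun i => ?_
  refine Fin.cases ?_ (fun k => ?_) i
  · exact hS.mul_one_sub_X 0
  · exact ((hQ k).mul_one_sub_X 0).sub (hS.mul_X _)

theorem inner_eq_sum {m : ℕ} (x y : EuclideanSpace ℝ (Fin m)) : inner ℝ x y = ∑ i, x i * y i := by
  rw [PiLp.inner_apply]
  exact Finset.sum_congr rfl fun i _ => by simp [mul_comm]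

/-- With S = ∑ y_k Q_k the inner product is S(1 - y₀)(1 + y₀) - S ∑ y_k², which vanishes when y₀² +
∑ y_k² = 1. -/
theorem tangentToSphere_sphereField (d : ℕ) (P : PolyField n) :
    (sphereField d P).TangentToSphere := by
  intro y hy
  have h1 : y 0 ^ 2 + ∑ k : Fin n, y k.succ ^ 2 = 1 := by
    rw [unitSphere, mem_sphere_zero_iff_norm] at hy
    rw [← Fin.sum_univ_succ (fun i => y i ^ 2), ← EuclideanSpace.real_norm_sq_eq, hy, one_pow]
  set s := eval (fun j => y j) (radialPart d P) with hs
  have hs' : s = ∑ k : Fin n, eval (fun j => y j) (homog d (P k)) * y k.succ := by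
    simp [hs, radialPart]
  have e0 : (sphereField d P).toFun y 0 = s * (1 - y 0) := by
    simp [PolyField.toFun, sphereField_zero, hs]
  have ek : ∀ k : Fin n, (sphereField d P).toFun y k.succ
      = eval (fun j => y j) (homog d (P k)) * (1 - y 0) - s * y k.succ := fun k => by
    simp [PolyField.toFun, sphereField_succ, hs]
  rw [inner_eq_sum, Fin.sum_univ_succ, e0]
  simp only [ek]
  have : ∑ k : Fin n, y k.succ * (eval (fun j => y j) (homog d (P k)) * (1 - y 0) - s * y k.succ)
      = s * (1 - y 0) - s * ∑ k : Fin n, y k.succ ^ 2 := by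
    rw [hs', Finset.sum_mul, ← hs', Finset.mul_sum, ← Finset.sum_sub_distrib]
    exact Finset.sum_congr rfl fun k _ => by ring
  rw [this]
  linear_combination (-s) * h1

theorem sphereField_northPole (d : ℕ) (P : PolyField n) :
    (sphereField d P).toFun (northPole n) = 0 := by
  have h0 : northPole n 0 = 1 := by simp [northPole]
  have hk : ∀ k : Fin n, northPole n k.succ = 0 := fun k => by
    simp [northPole, Fin.succ_ne_zero]
  have hS : eval (fun j => northPole n j) (radialPart d P) = 0 := by
    simp [radialPart, hk]
  ext i
  refine Fin.cases ?_ (fun k => ?_) i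
  · simp [PolyField.toFun, sphereField_zero, hS]
  · simp [PolyField.toFun, sphereField_succ, hS, h0]

theorem aeval_eq_eval_real {σ : Type*} (f : σ → ℝ) (p : MvPolynomial σ ℝ) :
    aeval f p = eval f p := by
  rw [aeval_def, Algebra.algebraMap_self]
  rfl

theorem totalDegree_le_degree {m : ℕ} (P : PolyField m) (i : Fin m) :
    (P i).totalDegree ≤ P.degree :=
  Finset.le_sup (f := fun i => (P i).totalDegree) (Finset.mem_univ i)

/-- At y = φ(x) the homogenized components are the components of v = (1 - y₀)^d P(x), and the radial
part is (1 - y₀)⟨x, v⟩. Inserting this into `fderiv_invStereo` gives the formula. -/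
theorem sphereField_invStereo (P : PolyField n) (x : EuclideanSpace ℝ (Fin n)) :
    (sphereField P.degree P).toFun (invStereo n x) =
      fderiv ℝ (invStereo n) x (((2 : ℝ) ^ P.degree / (1 + ‖x‖ ^ 2) ^ P.degree) • P.toFun x) := by
  have hne : 1 + ‖x‖ ^ 2 ≠ 0 := by positivity
  have h0 := one_sub_invStereo_zero x
  have hk : ∀ k : Fin n, invStereo n x k.succ = (1 - invStereo n x 0) * x k := fun k => by
    rw [h0, invStereo_succ]
    ring
  have hQ : ∀ k, eval (fun j => invStereo n x j) (homog P.degree (P k))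
      = (2 / (1 + ‖x‖ ^ 2)) ^ P.degree * P.toFun x k := fun k => by
    have := aeval_homog (totalDegree_le_degree P k) (fun j => invStereo n x j) (fun j => x j) hk
    rwa [aeval_eq_eval_real, aeval_eq_eval_real, h0] at this
  have hS : eval (fun j => invStereo n x j) (radialPart P.degree P)
      = (2 / (1 + ‖x‖ ^ 2)) ^ (P.degree + 1) * inner ℝ x (P.toFun x) := by
    rw [inner_eq_sum, Finset.mul_sum, radialPart, map_sum]
    refine Finset.sum_congr rfl fun k _ => ?_
    rw [map_mul, hQ, eval_X, hk, h0]
    ring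
  rw [← div_pow, fderiv_invStereo]
  ext i
  refine Fin.cases ?_ (fun k => ?_) i
  · have e : (sphereField P.degree P).toFun (invStereo n x) 0
        = eval (fun j => invStereo n x j) (radialPart P.degree P * (1 - X 0)) := rfl
    rw [e, map_mul, map_sub, map_one, eval_X, hS, h0]
    simp only [Fin.cons_zero, inner_smul_right, pow_succ]
    generalize (2 / (1 + ‖x‖ ^ 2)) ^ P.degree = c
    field_simp
    ring
  · have e : (sphereField P.degree P).toFun (invStereo n x) k.succ = eval
        (fun j => invStereo n x j) (homog P.degree (P k) * (1 - X 0)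
          - radialPart P.degree P * X k.succ) := rfl
    rw [e, map_sub, map_mul, map_mul, map_sub, map_one, eval_X, eval_X, hS, hQ, hk, h0]
    simp only [Fin.cons_succ, inner_smul_right, PiLp.smul_apply, smul_eq_mul, pow_succ]
    generalize (2 / (1 + ‖x‖ ^ 2)) ^ P.degree = c
    field_simp
    ring

theorem degree_sphereField {d : ℕ} {P : PolyField n} (hd : ∀ k, (P k).totalDegree ≤ d) {i : Fin n}
    (hi : P i = X i ^ d) : (sphereField d P).degree = d + 2 := by
  have hQ : ∀ k, (homog d (P k)).totalDegree ≤ d := fun k => totalDegree_homog_le (hd k)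
  have hS : (radialPart d P).totalDegree ≤ d + 1 := totalDegree_finsetSum_le fun k _ =>
    (totalDegree_mul _ _).trans (by rw [totalDegree_X]; have := hQ k; omega)
  have h1 := totalDegree_one_sub_X_le (0 : Fin (n + 1))
  refine le_antisymm (Finset.sup_le fun j _ => ?_) ?_
  · refine Fin.cases ?_ (fun k => ?_) j
    · exact (totalDegree_mul _ _).trans (by omega)
    · refine (totalDegree_sub _ _).trans (max_le ?_ ?_)
      · exact (totalDegree_mul _ _).trans (add_le_add (hQ k) h1 |>.trans (by omega))
      · exact (totalDegree_mul _ _).trans (by rw [totalDegree_X]; omega)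
  · refine le_trans ?_ (totalDegree_le_degree _ 0)
    rw [sphereField_zero]
    -- For the lower bound, restrict to the line where y₀ and the variable of x_i equal T and all
    -- others vanish. The first component becomes T^(d+1) (1 - T), so its top-degree part does not
    -- cancel.
    let f : Fin (n + 1) → Polynomial ℝ :=
      Fin.cons Polynomial.X fun k => if k = i then Polynomial.X else 0
    have hf : ∀ j, (f j).natDegree ≤ 1 := fun j => by
      refine Fin.cases ?_ (fun k => ?_) j
      · exact Polynomial.natDegree_X_le
      · by_cases hk : k = i <;> simp [f, hk]
    have hle := aeval_natDegree_le (radialPart d P * (1 - X 0)) le_rfl f hf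
    have hval : aeval f (radialPart d P * (1 - X 0))
        = Polynomial.X ^ (d + 1) * (1 - Polynomial.X) := by
      rw [map_mul, radialPart, map_sum, Finset.sum_eq_single i]
      · rw [map_mul, hi, homog_X_pow]
        simp [f, pow_succ]
      · intro k _ hk
        simp [f, hk]
      · simp
    have hdeg : (Polynomial.X ^ (d + 1) * (1 - Polynomial.X) : Polynomial ℝ).natDegree = d + 2 := by
      have : (Polynomial.X ^ (d + 1) * (1 - Polynomial.X) : Polynomial ℝ)
          = -(Polynomial.X ^ (d + 1) * (Polynomial.X - Polynomial.C 1)) := by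
        rw [Polynomial.C_1]; ring
      rw [this, Polynomial.natDegree_neg, Polynomial.natDegree_mul (by simp)
        (Polynomial.X_sub_C_ne_zero 1), Polynomial.natDegree_X_pow, Polynomial.natDegree_X_sub_C]
    rw [hval, hdeg, mul_one] at hle
    exact hle

/-- A complete trajectory of `P` gives a complete trajectory on the sphere. -/
theorem exists_sphere_trajectory {P : PolyField n} {γ : ℝ → EuclideanSpace ℝ (Fin n)}
    (hγ : ∀ t, HasDerivAt γ (P.toFun (γ t)) t) :
    ∃ η : ℝ → EuclideanSpace ℝ (Fin (n + 1)), η 0 = invStereo n (γ 0) ∧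
      (∀ t, HasDerivAt η ((sphereField P.degree P).toFun (η t)) t) ∧
      Set.range η = invStereo n '' Set.range γ := by
  have hγc : Continuous γ := continuous_iff_continuousAt.2 fun t => (hγ t).continuousAt
  obtain ⟨σ, h0, hsurj, hσ⟩ := exists_time_change
    (g := fun t => ((1 + ‖γ t‖ ^ 2) / 2) ^ P.degree) (by fun_prop) (c := (1 / 2) ^ P.degree)
    (by positivity) fun t => by gcongr; nlinarith [sq_nonneg ‖γ t‖]
  refine ⟨fun s => invStereo n (γ (σ s)), by simp only [h0], fun s => ?_, ?_⟩
  · have h1 := (hγ (σ s)).scomp s (hσ s)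
    have h2 := (differentiable_invStereo (γ (σ s))).hasFDerivAt.comp_hasDerivAt s h1
    rw [sphereField_invStereo, ← div_pow]
    rwa [← inv_pow, inv_div] at h2
  · rw [← Set.range_comp]
    exact (hsurj.range_comp (invStereo n ∘ γ))

end

end SphereTC

namespace SphereTC

open MvPolynomial

/-! ### Basic open sets with rational coefficients -/

theorem exists_polyWord {m : ℕ} (q : MvPolynomial (Fin m) ℚ) :
    ∃ f : PolyWord, ∀ y : EuclideanSpace ℝ (Fin m), polyValue f y = aeval (fun i => y i) q := by
  -- The denominator is lowered by one because `ratValue` divides by b + 1.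
  refine ⟨q.support.toList.map fun e =>
    (((coeff e q).num, (coeff e q).den - 1), List.ofFn fun i => e i), fun y => ?_⟩
  rw [polyValue, List.map_map, Finset.sum_map_toList, aeval_def, eval₂_eq']
  refine Finset.sum_congr rfl fun e _ => ?_
  have hden : (((coeff e q).den - 1 : ℕ) : ℝ) + 1 = (coeff e q).den := by
    rw [Nat.cast_sub (coeff e q).pos]
    simp
  have hc : ratValue ((coeff e q).num, (coeff e q).den - 1) = algebraMap ℚ ℝ (coeff e q) := by
    rw [ratValue, hden, eq_ratCast, Rat.cast_def]
  simp only [Function.comp_apply, hc]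
  congr 1
  refine Finset.prod_congr rfl fun i _ => ?_
  simp [List.getD_eq_getElem?_getD]

theorem exists_semialgOpen {m : ℕ} (qs : List (MvPolynomial (Fin m) ℚ)) :
    ∃ L : List (List PolyWord), ∀ y : EuclideanSpace ℝ (Fin m),
      y ∈ semialgOpen m L ↔ ∀ q ∈ qs, 0 < aeval (fun i => y i) q := by
  choose f hf using exists_polyWord (m := m)
  refine ⟨[qs.map f], fun y => ?_⟩
  simp [semialgOpen, hf]

/-- Homogenization multiplies a value by a power of 1 - y₀, which is positive on the image of φ, so
signs do not change. -/
theorem exists_semialgOpen_sphere {n : ℕ} (qs : List (MvPolynomial (Fin n) ℚ)) :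
    ∃ L : List (List PolyWord), ∀ x : EuclideanSpace ℝ (Fin n),
      invStereo n x ∈ semialgOpen (n + 1) L ↔ ∀ q ∈ qs, 0 < aeval (fun i => x i) q := by
  obtain ⟨L, hL⟩ := exists_semialgOpen (qs.map fun q => homog q.totalDegree q)
  refine ⟨L, fun x => ?_⟩
  have h0 := one_sub_invStereo_zero x
  have hk : ∀ k : Fin n, invStereo n x k.succ = (1 - invStereo n x 0) * x k := fun k => by
    rw [h0, invStereo_succ]
    ring
  have hpos : 0 < 1 - invStereo n x 0 := by rw [h0]; positivity
  rw [hL, List.forall_mem_map]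
  refine forall₂_congr fun q _ => ?_
  rw [aeval_homog le_rfl (fun j => invStereo n x j) (fun j => x j) hk]
  exact mul_pos_iff_of_pos_left (pow_pos hpos _)

/-! ### The halting sequence -/

/-- The sequence in which `encode W + 1` occurs if and only if the machine described by `W` halts
with the required output. -/
def haltSeq (j : ℕ) : ℕ :=
  if 2 ≤ j ∧ haltsWithin
      ((Encodable.decode (α := List (List ℕ)) (Nat.unpair (j - 2)).1).getD [])
      (Nat.unpair (j - 2)).2 = true
  then (Nat.unpair (j - 2)).1 + 1 else 0

theorem haltSeq_le (j : ℕ) : haltSeq j ≤ j + 1 := by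
  unfold haltSeq
  split_ifs
  · have := Nat.unpair_left_le (j - 2)
    omega
  · omega

theorem computable_haltSeq : Computable haltSeq := by
  have hu : Primrec fun j : ℕ => Nat.unpair (j - 2) :=
    Primrec.unpair.comp (Primrec.nat_sub.comp Primrec.id (Primrec.const 2))
  have hW : Primrec fun j : ℕ =>
      (Encodable.decode (α := List (List ℕ)) (Nat.unpair (j - 2)).1).getD [] :=
    Primrec.option_getD.comp (Primrec.decode.comp (Primrec.fst.comp hu)) (Primrec.const [])
  have h1 : PrimrecPred fun j : ℕ => 2 ≤ j := Primrec.nat_le.comp (Primrec.const 2) Primrec.id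
  have h2 : PrimrecPred fun j : ℕ => haltsWithin
      ((Encodable.decode (α := List (List ℕ)) (Nat.unpair (j - 2)).1).getD [])
      (Nat.unpair (j - 2)).2 = true :=
    Primrec.eq.comp (primrec_haltsWithin.comp hW (Primrec.snd.comp hu)) (Primrec.const true)
  exact (Primrec.ite (h1.and h2) (Primrec.succ.comp (Primrec.fst.comp hu))
    (Primrec.const 0)).to_comp

theorem exists_haltSeq_eq_iff (W : List (List ℕ)) :
    (∃ i, 1 ≤ i ∧ haltSeq (i + 1) = Encodable.encode W + 1) ↔ ∃ j, haltsWithin W j = true := by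
  constructor
  · rintro ⟨i, -, hi⟩
    unfold haltSeq at hi
    split_ifs at hi with h
    rw [Nat.add_right_cancel hi, Encodable.encodek] at h
    exact ⟨_, h.2⟩
  · rintro ⟨j, hj⟩
    -- The index i + 1 is the pair shifted by 2. This shift makes the coefficients 0 and 1 vanish,
    -- so every occurrence has i ≥ 1, as `accepts_of_lacDen` demands.
    refine ⟨Nat.pair (Encodable.encode W) j + 1, by omega, ?_⟩
    unfold haltSeq
    simp [hj]

theorem two_le_of_haltSeq_ne_zero {i : ℕ} (h : haltSeq i ≠ 0) : 2 ≤ i := by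
  unfold haltSeq at h
  split_ifs at h with h'
  exacts [h'.1, absurd rfl h]

/-- The frequency `∑ j, haltSeq j / lacDen j`. It is a computable real number because each term
depends only on a simulation with a bounded number of steps; the trajectory of the rotation with
this frequency comes close to a prescribed multiple of the reference frequency, at one of the times
`2 π lacDen j`, if and only if some term records that the machine has halted. -/
noncomputable def haltFreq : ℝ := lacSum haltSeq

/-- The reference frequency `∑ j, 1 / lacDen j`. -/
noncomputable def refFreq : ℝ := lacSum fun _ => 1

theorem isComputableReal_haltFreq : IsComputableReal haltFreq :=
  isComputableReal_lacSum haltSeq_le computable_haltSeq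

theorem isComputableReal_refFreq : IsComputableReal refFreq :=
  isComputableReal_lacSum (fun j => by simp) (Computable.const 1)

theorem exists_accepts_iff (W : List (List ℕ)) :
    (∃ t, Accepts haltFreq refFreq ((Encodable.encode W + 1 : ℕ) : ℝ) t) ↔
      ∃ j, haltsWithin W j = true := by
  rw [← exists_haltSeq_eq_iff]
  constructor
  · rintro ⟨t, ht⟩
    obtain ⟨i, hi⟩ := ht.exists_coeff_eq haltSeq_le (by omega)
    have := two_le_of_haltSeq_ne_zero (i := i) (by omega)
    exact ⟨i - 1, by omega, by rw [Nat.sub_add_cancel (by omega), hi]⟩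
  · rintro ⟨i, hi, h⟩
    rw [← h]
    exact ⟨_, accepts_of_lacDen haltSeq_le hi (by omega)⟩

/-! ### The vector field -/

section

variable {n : ℕ}

/-- The components of the field: a clock, three rotations with the frequencies `1`, `β`, `α`,
a parameter, and the last component `x ^ 56`. -/
noncomputable def searchComponent (α β : ℝ) (hn : 17 ≤ n) : ℕ → MvPolynomial (Fin n) ℝ
  | 0 => 1
  | 1 => -X (Fin.castLE hn 2)
  | 2 => X (Fin.castLE hn 1)
  | 3 => -(C β * X (Fin.castLE hn 4))
  | 4 => C β * X (Fin.castLE hn 3)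
  | 5 => -(C α * X (Fin.castLE hn 6))
  | 6 => C α * X (Fin.castLE hn 5)
  | 16 => X (Fin.castLE hn 16) ^ 56
  | _ => 0

/-- The vector field. -/
noncomputable def searchField (α β : ℝ) (hn : 17 ≤ n) : PolyField n :=
  fun i => searchComponent α β hn i

/-- The coordinates of the trajectories of the field. -/
noncomputable def searchCoord (α β w t : ℝ) : ℕ → ℝ
  | 0 => t
  | 1 => Real.cos t
  | 2 => Real.sin t
  | 3 => Real.cos (β * t)
  | 4 => Real.sin (β * t)
  | 5 => Real.cos (α * t)
  | 6 => Real.sin (α * t)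
  | 7 => w
  | _ => 0

/-- The trajectory with parameter `w`. -/
noncomputable def searchCurve (n : ℕ) (α β w t : ℝ) : EuclideanSpace ℝ (Fin n) :=
  WithLp.toLp 2 fun i => searchCoord α β w t i

theorem searchCurve_castLE (hn : 17 ≤ n) (α β w t : ℝ) (k : Fin 17) :
    searchCurve n α β w t (Fin.castLE hn k) = searchCoord α β w t k := rfl

theorem searchField_constructible {α β : ℝ} (hα : IsComputableReal α) (hβ : IsComputableReal β)
    (hn : 17 ≤ n) : (searchField α β hn).Constructible := by
  have key : ∀ k, HasComputableCoeffs (searchComponent α β hn k) := fun k => by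
    have h1 : HasComputableCoeffs (1 : MvPolynomial (Fin n) ℝ) := by
      simpa using HasComputableCoeffs.C (σ := Fin n) IsComputableReal.one
    have hX : ∀ (i : Fin n) (e : ℕ), HasComputableCoeffs (X i ^ e : MvPolynomial (Fin n) ℝ) :=
      fun i e => by simpa using h1.mul_X_pow i e
    have hX' : ∀ i : Fin n, HasComputableCoeffs (X i : MvPolynomial (Fin n) ℝ) :=
      fun i => by simpa using hX i 1
    unfold searchComponent
    split
    exacts [h1, (hX' _).neg, hX' _, ((HasComputableCoeffs.C hβ).mul_X _).neg,
      (HasComputableCoeffs.C hβ).mul_X _, ((HasComputableCoeffs.C hα).mul_X _).neg,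
      (HasComputableCoeffs.C hα).mul_X _, hX _ _, .zero]
  exact fun i => key i

theorem totalDegree_searchField_le (α β : ℝ) (hn : 17 ≤ n) (i : Fin n) :
    (searchField α β hn i).totalDegree ≤ 56 := by
  have hC : ∀ (a : ℝ) (j : Fin n), (C a * X j : MvPolynomial (Fin n) ℝ).totalDegree ≤ 1 :=
    fun a j => (totalDegree_mul _ _).trans (by simp)
  have hC' : ∀ (a : ℝ) (j : Fin n), (C a * X j : MvPolynomial (Fin n) ℝ).totalDegree ≤ 56 :=
    fun a j => (hC a j).trans (by norm_num)
  unfold searchField searchComponent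
  split <;> simp [totalDegree_neg, totalDegree_X_pow, hC']

theorem degree_searchField (α β : ℝ) (hn : 17 ≤ n) : (searchField α β hn).degree = 56 := by
  refine le_antisymm (Finset.sup_le fun i _ => totalDegree_searchField_le α β hn i) ?_
  refine le_trans (le_of_eq ?_) (totalDegree_le_degree _ (Fin.castLE hn 16))
  rw [show searchField α β hn (Fin.castLE hn 16) = X (Fin.castLE hn 16) ^ 56 from rfl,
    totalDegree_X_pow]

theorem hasDerivAt_searchCurve (α β w : ℝ) (hn : 17 ≤ n) (t : ℝ) :
    HasDerivAt (searchCurve n α β w) ((searchField α β hn).toFun (searchCurve n α β w t)) t := by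
  refine hasDerivAt_toLp fun i => ?_
  have hc : ∀ c : ℝ, HasDerivAt (fun s => Real.cos (c * s)) (-(c * Real.sin (c * t))) t :=
    fun c => by
      have := ((hasDerivAt_id t).const_mul c).cos
      simpa [mul_comm] using this
  have hs : ∀ c : ℝ, HasDerivAt (fun s => Real.sin (c * s)) (c * Real.cos (c * t)) t :=
    fun c => by
      have := ((hasDerivAt_id t).const_mul c).sin
      simpa [mul_comm] using this
  have key : ∀ k : ℕ, HasDerivAt (fun s => searchCoord α β w s k)
      (eval (fun j => searchCurve n α β w t j) (searchComponent α β hn k)) t := fun k => by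
    unfold searchComponent
    split
    · rw [map_one]
      exact hasDerivAt_id' t
    · simpa [searchCurve_castLE, searchCoord] using Real.hasDerivAt_cos t
    · simpa [searchCurve_castLE, searchCoord] using Real.hasDerivAt_sin t
    · simpa [searchCurve_castLE, searchCoord] using hc β
    · simpa [searchCurve_castLE, searchCoord] using hs β
    · simpa [searchCurve_castLE, searchCoord] using hc α
    · simpa [searchCurve_castLE, searchCoord] using hs α
    -- Coordinate 16 rests at the zero of x ^ 56, so this nonlinear term never influences the
    -- trajectory.
    · simpa [searchCurve_castLE, searchCoord] using hasDerivAt_const t (0 : ℝ)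
    · rename_i h0 h1 h2 h3 h4 h5 h6 _
      rw [map_zero]
      unfold searchCoord
      split
      · exact absurd rfl h0
      · exact absurd rfl h1
      · exact absurd rfl h2
      · exact absurd rfl h3
      · exact absurd rfl h4
      · exact absurd rfl h5
      · exact absurd rfl h6
      all_goals exact hasDerivAt_const t _
  exact key i

/-- The polynomials that cut out the accepting set. -/
noncomputable def acceptPolys (hn : 17 ≤ n) : List (MvPolynomial (Fin n) ℚ) :=
  let x : Fin 17 → MvPolynomial (Fin n) ℚ := fun k => X (Fin.castLE hn k)
  [x 0, x 3, x 5, x 4, x 4 ^ 4 - 16 * (1 - x 1), 1 - x 4 * x 0 ^ 2, 1 - 1000 * (x 7 ^ 2 * x 4),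
    x 4 ^ 2 - 4 * (x 6 - x 7 * x 4) ^ 2]

theorem acceptPolys_pos_iff (hn : 17 ≤ n) (α β w t : ℝ) :
    (∀ q ∈ acceptPolys hn, 0 < aeval (fun i => searchCurve n α β w t i) q) ↔
      Accepts α β w t := by
  have e0 : searchCurve n α β w t (Fin.castLE hn 0) = t := rfl
  have e1 : searchCurve n α β w t (Fin.castLE hn 1) = Real.cos t := rfl
  have e3 : searchCurve n α β w t (Fin.castLE hn 3) = Real.cos (β * t) := rfl
  have e4 : searchCurve n α β w t (Fin.castLE hn 4) = Real.sin (β * t) := rfl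
  have e5 : searchCurve n α β w t (Fin.castLE hn 5) = Real.cos (α * t) := rfl
  have e6 : searchCurve n α β w t (Fin.castLE hn 6) = Real.sin (α * t) := rfl
  have e7 : searchCurve n α β w t (Fin.castLE hn 7) = w := rfl
  simp only [acceptPolys, List.forall_mem_cons, List.not_mem_nil, false_imp_iff, implies_true,
    and_true, map_sub, map_mul, map_pow, map_one, aeval_X, map_ofNat, e0, e1, e3, e4, e5, e6, e7,
    Accepts]
  constructor <;> rintro ⟨h1, h2, h3, h4, h5, h6, h7, h8⟩ <;>
    exact ⟨h1, h2, h3, h4, by linarith, by linarith, by linarith, by linarith⟩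

/-! ### Initial points -/

/-- The fractions that give the initial point of the trajectory with parameter `w`. -/
def startFractions (w : ℕ) : List (ℤ × ℕ) :=
  [(0, 0), (1, 0), (0, 0), (1, 0), (0, 0), (1, 0), (0, 0), ((w : ℤ), 0)]

/-- The fractions that give the image of this point on the sphere. -/
def sphereStartFractions (w : ℕ) : List (ℤ × ℕ) :=
  -- The initial point has r² = 3 + w², so the denominator is 1 + r² = w² + 4, written as (w² + 3) +
  -- 1.
  [(((w * w + 2 : ℕ) : ℤ), w * w + 3), (0, 0), (2, w * w + 3), (0, 0), (2, w * w + 3), (0, 0),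
    (2, w * w + 3), (0, 0), (((2 * w : ℕ) : ℤ), w * w + 3)]

theorem primrec_startFractions : Primrec startFractions := by
  have hw : Primrec fun w : ℕ => ((w : ℤ), 0) :=
    Primrec.pair primrec_int_natCast (Primrec.const 0)
  unfold startFractions
  iterate 7 refine Primrec.list_cons.comp (Primrec.const _) ?_
  exact Primrec.list_cons.comp hw (Primrec.const [])

theorem primrec_sphereStartFractions : Primrec sphereStartFractions := by
  have hsq : ∀ c : ℕ, Primrec fun w : ℕ => w * w + c := fun c =>
    Primrec.nat_add.comp (Primrec.nat_mul.comp Primrec.id Primrec.id) (Primrec.const c)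
  have h2 : Primrec fun w : ℕ => ((2 : ℤ), w * w + 3) := Primrec.pair (Primrec.const 2) (hsq 3)
  have h0 : Primrec fun _ : ℕ => ((0 : ℤ), 0) := Primrec.const _
  unfold sphereStartFractions
  refine Primrec.list_cons.comp (Primrec.pair (primrec_int_natCast.comp (hsq 2)) (hsq 3)) ?_
  refine Primrec.list_cons.comp h0 (Primrec.list_cons.comp h2 ?_)
  refine Primrec.list_cons.comp h0 (Primrec.list_cons.comp h2 ?_)
  refine Primrec.list_cons.comp h0 (Primrec.list_cons.comp h2 ?_)
  refine Primrec.list_cons.comp h0 (Primrec.list_cons.comp ?_ (Primrec.const []))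
  exact Primrec.pair (primrec_int_natCast.comp Primrec.nat_double) (hsq 3)

theorem ratPoint_startFractions (α β : ℝ) (w : ℕ) :
    ratPoint n (startFractions w) = searchCurve n α β w 0 := by
  have key : ∀ k : ℕ, ratValue ((startFractions w).getD k (0, 0)) = searchCoord α β w 0 k := by
    rintro (_ | _ | _ | _ | _ | _ | _ | _ | k) <;> simp [startFractions, ratValue, searchCoord]
  ext i
  exact key i

theorem norm_sq_searchCurve_zero (hn : 17 ≤ n) (α β w : ℝ) :
    ‖searchCurve n α β w 0‖ ^ 2 = 3 + w ^ 2 := by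
  obtain ⟨m, rfl⟩ := Nat.exists_eq_add_of_le (show 8 ≤ n by omega)
  rw [EuclideanSpace.real_norm_sq_eq]
  have h : ∀ i : Fin (8 + m), searchCurve (8 + m) α β w 0 i ^ 2
      = (fun k : ℕ => searchCoord α β w 0 k ^ 2) i := fun _ => rfl
  simp_rw [h]
  rw [Fin.sum_univ_eq_sum_range (fun k : ℕ => searchCoord α β w 0 k ^ 2) (8 + m),
    Finset.sum_range_add, Finset.sum_eq_zero (s := Finset.range m)]
  · simp [Finset.sum_range_succ, searchCoord]
    ring
  · intro k _
    rw [add_comm 8 k]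
    simp [searchCoord]

theorem ratPoint_sphereStartFractions (hn : 17 ≤ n) (α β : ℝ) (w : ℕ) :
    ratPoint (n + 1) (sphereStartFractions w) = invStereo n (searchCurve n α β w 0) := by
  have hsq := norm_sq_searchCurve_zero hn α β w
  ext i
  refine Fin.cases ?_ (fun k => ?_) i
  · rw [invStereo_zero, hsq]
    simp [ratPoint, sphereStartFractions, ratValue]
    congr 1 <;> ring
  · rw [invStereo_succ, hsq]
    have key : ∀ k : ℕ, ratValue ((sphereStartFractions w).getD (k + 1) (0, 0))
        = 2 * searchCoord α β w 0 k / (1 + (3 + (w : ℝ) ^ 2)) := by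
      have hd : (w : ℝ) * w + 3 + 1 = 1 + (3 + (w : ℝ) ^ 2) := by ring
      rintro (_ | _ | _ | _ | _ | _ | _ | _ | k) <;>
        simp [sphereStartFractions, ratValue, searchCoord, hd]
    exact key k

end

/-! ### The theorem -/

/-- Used for both ℝⁿ and the sphere. The description L is one constant list, so computability of the
open set is trivial. -/
theorem turingComplete_of_range {m : ℕ} {M : Set (EuclideanSpace ℝ (Fin m))}
    {X : EuclideanSpace ℝ (Fin m) → EuclideanSpace ℝ (Fin m)} (hX : LocallyLipschitz X)
    {fractions : ℕ → List (ℤ × ℕ)} (hf : Primrec fractions) (L : List (List PolyWord))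
    (h : ∀ w : ℕ, ∃ η : ℝ → EuclideanSpace ℝ (Fin m), η 0 = ratPoint m (fractions w) ∧
      (∀ t, HasDerivAt η (X (η t)) t) ∧ (∀ t, η t ∈ M) ∧
      ((Set.range η ∩ semialgOpen m L).Nonempty ↔ ∃ t, Accepts haltFreq refFreq w t)) :
    TuringComplete M X := by
  refine ⟨fun W => fractions (Encodable.encode W + 1), fun _ => L,
    (hf.comp (Primrec.succ.comp Primrec.encode)).to_comp, Computable.const L, ?_⟩
  intro k r s _ T k₀ t ht u
  obtain ⟨η, h0, hη, hM, hacc⟩ := h (Encodable.encode (T.describe k₀ t k u) + 1)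
  rw [← h0]
  refine ⟨hM 0, ?_⟩
  rw [orbit_eq_range hX hη hM, ← T.exists_haltsWithin_describe_iff k₀ t ht k u,
    ← exists_accepts_iff, ← hacc, ← Set.inter_assoc,
    Set.inter_eq_left.2 (Set.range_subset_iff.2 hM)]

end SphereTC

theorem theorem4p1 (n : ℕ) (hn : 17 ≤ n) :
    ∃ (P : SphereTC.PolyField n) (X : SphereTC.PolyField (n + 1)),
      -- the polynomial field on Euclidean space
      P.Constructible ∧ P.degree = 56 ∧ SphereTC.TuringComplete Set.univ P.toFun ∧
      -- the polynomial field on the sphere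
      X.Constructible ∧ X.degree = 58 ∧ X.TangentToSphere ∧
      SphereTC.TuringComplete (SphereTC.unitSphere n) X.toFun ∧
      -- it is the push-forward of the reparametrized field
      (∀ x : EuclideanSpace ℝ (Fin n),
        X.toFun (SphereTC.invStereo n x) =
          fderiv ℝ (SphereTC.invStereo n) x
            (((2 : ℝ) ^ P.degree / (1 + ‖x‖ ^ 2) ^ P.degree) • P.toFun x)) ∧
      X.toFun (SphereTC.northPole n) = 0 := by
  open SphereTC in
  set P : PolyField n := searchField haltFreq refFreq hn with hP
  have hc : P.Constructible :=
    searchField_constructible isComputableReal_haltFreq isComputableReal_refFreq hn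
  have hdeg : P.degree = 56 := degree_searchField _ _ hn
  obtain ⟨L, hL⟩ := exists_semialgOpen (acceptPolys hn)
  obtain ⟨L', hL'⟩ := exists_semialgOpen_sphere (acceptPolys hn)
  refine ⟨P, sphereField P.degree P, hc, hdeg, ?_, hc.sphereField _, ?_,
    tangentToSphere_sphereField _ _, ?_, sphereField_invStereo P, sphereField_northPole _ _⟩
  · refine turingComplete_of_range P.locallyLipschitz_toFun primrec_startFractions L fun w =>
      ⟨searchCurve n haltFreq refFreq w, (ratPoint_startFractions _ _ w).symm,
        hasDerivAt_searchCurve _ _ _ hn, fun _ => Set.mem_univ _, ?_⟩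
    simp only [Set.Nonempty, Set.mem_inter_iff, Set.mem_range, exists_exists_eq_and, hL,
      acceptPolys_pos_iff]
  · rw [degree_sphereField (totalDegree_le_degree P) (i := Fin.castLE hn 16) (by rw [hdeg]; rfl),
      hdeg]
  · refine turingComplete_of_range (sphereField P.degree P).locallyLipschitz_toFun
      primrec_sphereStartFractions L' fun w => ?_
    obtain ⟨η, h0, hη, hr⟩ :=
      exists_sphere_trajectory (hasDerivAt_searchCurve haltFreq refFreq (w : ℝ) hn)
    refine ⟨η, h0.trans (ratPoint_sphereStartFractions hn _ _ w).symm, hη, fun t => ?_, ?_⟩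
    · obtain ⟨x, -, hx⟩ := hr.subset (Set.mem_range_self t)
      exact hx ▸ invStereo_mem_unitSphere x
    · rw [hr]
      simp only [Set.Nonempty, Set.mem_inter_iff, Set.mem_image, Set.mem_range,
        exists_exists_eq_and, hL', acceptPolys_pos_iff]
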